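/- Let $n\ge 4$ be even. Put $\alpha(s)=e^{1/s}$ for $s<0$ and $\alpha(s)=0$ for $s\ge 0$. Equip $\mathbb R^n$ with the Riemannian metric $\sum g_{jk}\,dx_j\,dx_k$, $(g_{jk})=(g^{jk})^{-1}$, dual to the cometric $$\sum_{j,k=1}^n g^{jk}(x)\,d\xi_j\,d\xi_k=d\xi^2+2\alpha(x_{(n+2)/2})\sum_{j=1}^{(n-2)/2}d\xi_{n/2-j}\,d\xi_{(n+2)/2+j}.$$ Let $\mathrm{dist}$ be its Riemannian distance; integrals and $L^p$ norms are taken with respect to its Riemannian volume $dy$. Let $y^0\in\mathbb R^n$ be the point with $y^0_{(n+2)/2}=-1$ and all other coordinates $0$. Call $a$ an admissible amplitude if $0\le a\in C_0^\infty(\mathbb R^n\times\mathbb R^n)$, $a$ vanishes near the diagonal $\{x=y\}$, and $a(0,y^0)\ne 0$. For such $a$ set $$S_\lambda f(x)=\int e^{i\lambda\,\mathrm{dist}(x,y)}a(x,y)f(y)\,dy,$$ and, for $1\le p,q\le\infty$, consider the estimate $$(\ast)_{p,q}\qquad \forall\,\varepsilon>0\ \exists\, C\ \forall\,\lambda\ge1\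 \forall f\in L^p:\quad \|S_\lambda f\|_{L^q}\le C\lambda^{-n/q+\varepsilon}\|f\|_{L^p}.$$ Admissible amplitudes exist, and for every admissible amplitude $a$ and every $q$ with $\frac{2n}{n-1}<q\le\infty$: 1. if $(\ast)_{p,q}$ holds with the exponent $p\in[1,\infty]$ determined by $q=\frac{n+1}{n-1}p'$, $\frac1p+\frac1{p'}=1$, then $q\ge\frac{2(3n+2)}{3n-2}$; 2. if even only the weaker estimate $(\ast)_{\infty,q}$ holds, then $q\ge\frac{2(3n+2)}{3n-2}$. Moreover, $\frac{2(3n+2)}{3n-2}>\frac{2n}{n-1}$. -/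

import Mathlib

open MeasureTheory
open scoped ENNReal Manifold ContDiff Topology Matrix

noncomputable section

namespace CurvedOsc

/-- The underlying manifold `ℝⁿ`. -/
abbrev E (n : ℕ) : Type := EuclideanSpace ℝ (Fin n)

/-- The coordinate `x_j` of `x ∈ ℝⁿ` in the numbering `x = (x_1, …, x_n)`
(and `0` if `j` is not one of `1, …, n`). -/
def coord {n : ℕ} (x : E n) (j : ℕ) : ℝ :=
  if h : 1 ≤ j ∧ j ≤ n then x ⟨j - 1, by omega⟩ else 0

/-- `α(s) = e^{1/s}` for `s < 0`, and `α(s) = 0` for `s ≥ 0`. -/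
def alpha (s : ℝ) : ℝ := if s < 0 then Real.exp (1 / s) else 0

lemma alpha_nonneg (s : ℝ) : 0 ≤ alpha s := by
  unfold alpha; split_ifs <;> positivity

lemma alpha_lt_one (s : ℝ) : alpha s < 1 := by
  unfold alpha
  split_ifs with h
  · rw [Real.exp_lt_one_iff]; exact one_div_neg.2 h
  · exact zero_lt_one

/-- The positions `(i, k)`, in the numbering `1, …, n`, of the off-diagonal terms
`dξ_{n/2-j} dξ_{(n+2)/2+j}`, `1 ≤ j ≤ (n-2)/2`, of the cometric. The rows and columns of a
matrix are numbered from `0`, hence the shifts by one. -/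
def Coupled (n : ℕ) (i k : Fin n) : Prop :=
  ∃ j : ℕ, 1 ≤ j ∧ j ≤ (n - 2) / 2 ∧
    ((i.val + 1 = n / 2 - j ∧ k.val + 1 = (n + 2) / 2 + j) ∨
      (k.val + 1 = n / 2 - j ∧ i.val + 1 = (n + 2) / 2 + j))

open Classical in
/-- The matrix `(g^{ik}(x))` of the cometric
`dξ² + 2 α(x_{(n+2)/2}) ∑_{j=1}^{(n-2)/2} dξ_{n/2-j} dξ_{(n+2)/2+j}`. -/
def cometric {n : ℕ} (x : E n) : Matrix (Fin n) (Fin n) ℝ :=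
  Matrix.of fun i k =>
    (if i = k then 1 else 0) + alpha (coord x ((n + 2) / 2)) * (if Coupled n i k then 1 else 0)

/-- The matrix `(g_{ik}(x))` of the Riemannian metric dual to the cometric. -/
def metric {n : ℕ} (x : E n) : Matrix (Fin n) (Fin n) ℝ := (cometric x)⁻¹

lemma Coupled.symm {n : ℕ} {i k : Fin n} (h : Coupled n i k) : Coupled n k i := by
  obtain ⟨j, h1, h2, h3⟩ := h
  exact ⟨j, h1, h2, h3.symm⟩

lemma Coupled.unique {n : ℕ} {i k l : Fin n} (h : Coupled n i k) (h' : Coupled n i l) :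
    k = l := by
  obtain ⟨j, h1, h2, h3⟩ := h
  obtain ⟨j', h1', h2', h3'⟩ := h'
  ext
  omega

/-- The cometric is positive definite. -/
lemma cometric_posDef {n : ℕ} (x : E n) : (cometric x).PosDef := by
  classical
  set c := alpha (coord x ((n + 2) / 2)) with hc
  have hc0 : 0 ≤ c := alpha_nonneg _
  have hc1 : c < 1 := alpha_lt_one _
  refine Matrix.PosDef.of_dotProduct_mulVec_pos ?_ ?_
  · ext i k
    have h1 : (k = i) ↔ (i = k) := eq_comm
    have h2 : Coupled n k i ↔ Coupled n i k := ⟨Coupled.symm, Coupled.symm⟩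
    simp [cometric, h1, h2]
  · intro v hv
    set P : Fin n → Fin n → ℝ := fun i k => if Coupled n i k then 1 else 0 with hP
    have hP0 : ∀ i k, 0 ≤ P i k := fun i k => by simp only [hP]; split_ifs <;> norm_num
    have hPs : ∀ i k, P i k = P k i := fun i k => by
      have h2 : Coupled n k i ↔ Coupled n i k := ⟨Coupled.symm, Coupled.symm⟩
      simp [hP, h2]
    have hrow : ∀ i, ∑ k, P i k ≤ 1 := by
      intro i
      simp only [hP, Finset.sum_boole]
      have : (Finset.univ.filter fun k => Coupled n i k).card ≤ 1 :=
        Finset.card_le_one.2 fun a ha b hb => by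
          simp only [Finset.mem_filter] at ha hb
          exact ha.2.unique hb.2
      exact_mod_cast this
    have hsq : 0 < ∑ i, v i ^ 2 := by
      obtain ⟨i, hi⟩ := Function.ne_iff.1 hv
      exact Finset.sum_pos' (fun i _ => sq_nonneg _) ⟨i, Finset.mem_univ i, by
        have : v i ≠ 0 := hi
        positivity⟩
    have hR : ∑ i, ∑ k, P i k * v i ^ 2 ≤ ∑ i, v i ^ 2 := by
      refine Finset.sum_le_sum fun i _ => ?_
      rw [← Finset.sum_mul]
      nlinarith [hrow i, sq_nonneg (v i)]
    have hR' : ∑ i, ∑ k, P i k * v k ^ 2 = ∑ i, ∑ k, P i k * v i ^ 2 := by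
      rw [Finset.sum_comm]
      exact Finset.sum_congr rfl fun i _ => Finset.sum_congr rfl fun k _ => by rw [hPs]
    have hN : 0 ≤ ∑ i, ∑ k, P i k * (v i + v k) ^ 2 :=
      Finset.sum_nonneg fun i _ => Finset.sum_nonneg fun k _ => mul_nonneg (hP0 i k) (sq_nonneg _)
    have hexp : ∑ i, ∑ k, P i k * (v i + v k) ^ 2
        = ∑ i, ∑ k, P i k * v i ^ 2 + ∑ i, ∑ k, P i k * v k ^ 2
          + 2 * ∑ i, ∑ k, P i k * (v i * v k) := by
      simp only [Finset.mul_sum, ← Finset.sum_add_distrib]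
      exact Finset.sum_congr rfl fun i _ => Finset.sum_congr rfl fun k _ => by ring
    have hform : star v ⬝ᵥ (cometric x *ᵥ v)
        = ∑ i, v i ^ 2 + c * ∑ i, ∑ k, P i k * (v i * v k) := by
      simp only [dotProduct, Matrix.mulVec, cometric, Matrix.of_apply, Finset.mul_sum, star_trivial, add_mul, mul_add, Finset.sum_add_distrib]
      congr 1
      · exact Finset.sum_congr rfl fun i _ => by simp [sq]
      · exact Finset.sum_congr rfl fun i _ => Finset.sum_congr rfl fun k _ => by
          simp only [hP, hc]; ring
    rw [hform]
    nlinarith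

/-- The metric is positive definite, so that it is a Riemannian metric. -/
lemma metric_posDef {n : ℕ} (x : E n) : (metric x).PosDef := (cometric_posDef x).inv

/-- The Riemannian length `√(∑ g_{ik}(x) v_i v_k)` of a tangent vector `v` at `x`. -/
def tangentLength {n : ℕ} (x v : E n) : ℝ :=
  √ ((v : Fin n → ℝ) ⬝ᵥ (metric x *ᵥ (v : Fin n → ℝ)))

/-- The lengths of tangent vectors, as a family of extended norms on the tangent spaces. -/
@[reducible]
def tangentENorm (n : ℕ) (x : E n) : ENorm (TangentSpace 𝓘(ℝ, E n) x) where
  enorm v := ENNReal.ofReal (tangentLength x (show E n from v))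

/-- The Riemannian distance: the infimum of the lengths of the `C¹` paths from `x` to `y`. -/
def rdist {n : ℕ} (x y : E n) : ℝ :=
  (@Manifold.riemannianEDist (E n) _ _ (E n) _ 𝓘(ℝ, E n) (E n) _ _ (tangentENorm n) x y).toReal

/-- The Riemannian volume measure `√(det (g_{ik}(x))) dx`. -/
def vol (n : ℕ) : Measure (E n) :=
  (volume : Measure (E n)).withDensity fun x => ENNReal.ofReal (√ (metric x).det)

/-- The oscillatory integral `S_λ f(x) = ∫ e^{iλ dist(x, y)} a(x, y) f(y) dy`. -/
def oscInt {n : ℕ} (a : E n × E n → ℝ) (lam : ℝ) (f : E n → ℂ) (x : E n) : ℂ :=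
  ∫ y, Complex.exp (Complex.I * ((lam * rdist x y : ℝ) : ℂ)) * ((a (x, y) : ℝ) : ℂ) * f y ∂(vol n)

/-- The estimate `‖S_λ f‖_{L^q} ≤ C_ε λ^{-n/q+ε} ‖f‖_{L^p}`, for all `ε > 0`, `λ ≥ 1` and
`f ∈ L^p`. -/
def OscEstimate {n : ℕ} (a : E n × E n → ℝ) (p q : ℝ≥0∞) : Prop :=
  ∀ ε : ℝ, 0 < ε → ∃ C : ℝ, ∀ lam : ℝ, 1 ≤ lam → ∀ f : E n → ℂ, MemLp f p (vol n) →
    eLpNorm (oscInt a lam f) q (vol n) ≤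
      ENNReal.ofReal (C * lam ^ (-(n : ℝ) * (q⁻¹).toReal + ε)) * eLpNorm f p (vol n)

/-- The point `y` with `y_{(n+2)/2} = -1` and `y_j = 0` for `j ≠ (n+2)/2`. -/
def basePoint (n : ℕ) : E n :=
  WithLp.toLp 2 fun i => if i.val + 1 = (n + 2) / 2 then -1 else 0

/-- The amplitudes: `0 ≤ a ∈ C₀^∞(ℝⁿ × ℝⁿ)`, vanishing near the diagonal, and not zero at
`(0, y)`, where `y` is the point with `y_{(n+2)/2} = -1` and `y_j = 0` for `j ≠ (n+2)/2`. -/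
structure IsAmplitude {n : ℕ} (a : E n × E n → ℝ) : Prop where
  smooth : ContDiff ℝ ∞ a
  compactSupport : HasCompactSupport a
  nonneg : ∀ z, 0 ≤ a z
  vanishes_near_diagonal : ∀ x : E n, ∀ᶠ z in 𝓝 (x, x), a z = 0
  ne_zero : a (0, basePoint n) ≠ 0

end CurvedOsc

end

/-!
The counterexample is a Nikodym-type configuration of tubes. Let `t` be the coordinate
`x_{(n+2)/2}` and write the cometric as `I + α(t) P`. It depends on `t` only, so that all
components of the momentum except the one dual to `t` are conserved along geodesics. For a covector
`z` with time component `1` whose components after the time coordinate vanish, `⟨z, P z⟩ = 0`; hence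
`z` has the same length `|z|` at every point, the last component is conserved too, and the geodesics
with momentum `z / |z|` are the translates of the curve `t z + (∫₀ᵗ α) P z` (`ray`). For `t ≥ 0` the
second term vanishes, and the geodesics through points whose coordinates after the time coordinate
are `0` stay in the plane of dimension `(n + 2) / 2` where these coordinates are `0`. For `t` near
`-1` the second term is a nonzero multiple of `P z`, so that these geodesics, with `z` varying, fill
an open set there.

No theory of geodesics is required for the distance. The linear function `⟨z, x⟩ / |z|` solves the
eikonal equation, which bounds the distance from below by the difference of its values
(`IsMomentum.phase_sub_le_rdist`). An explicit path shows that in a tube of width `ρ` around such a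
geodesic this bound is sharp up to `O(ρ²)` (`IsMomentum.rdist_le_phase_sub`).

Let `δ = λ^{-1/2}` and take about `δ^{-(n-1)}` tubes of width a small multiple of `δ`, with
positions and momenta in a grid of spacing `δ`. Near `t = -1` they are disjoint (`eq_of_mem_tube`);
for `t ≥ 0` they all lie in a `δ`-neighbourhood `N` of the plane, of volume `O(δ^{(n-2)/2})`
(`vol_slab_le`). A wave packet with the linear phase of its tube, cut off to the part of the tube
near `t = -1`, has an oscillatory integral of size at least a multiple of `δ^{n-1}` on the part of
the tube in `N` (`le_norm_oscInt_of_phase`). A superposition of the packets with suitable signs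
(`exists_signs`) is bounded by `1`, and its oscillatory integral has `L²(N)` norm at least a
multiple of `δ^{n-1}`. By Hölder's inequality on `N`, the estimate for `L^q` then implies
`δ^{n-1} ≤ C δ^{2n/q - 2ε + (n-2)/2 · (1/2 - 1/q)}` for all small `δ`, and comparing exponents gives
`q ≥ 2(3n+2)/(3n-2)` (`inv_le_of_oscEstimate`). Since the test functions are bounded and live on a
fixed set, the exponent `p` does not matter.
-/

noncomputable section

namespace CurvedOsc

/-! ### The cometric -/

lemma alpha_eq_expNegInvGlue (s : ℝ) : alpha s = expNegInvGlue (-s) := by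
  unfold alpha expNegInvGlue
  split_ifs with h h' h'
  · linarith
  · simp [one_div, inv_neg]
  · rfl
  · linarith

lemma continuous_alpha : Continuous alpha := by
  have : alpha = fun s => expNegInvGlue (-s) := funext alpha_eq_expNegInvGlue
  rw [this]
  exact (expNegInvGlue.contDiff (n := 0)).continuous.comp continuous_neg

lemma alpha_antitone : Antitone alpha := fun s t h => by
  rw [alpha_eq_expNegInvGlue, alpha_eq_expNegInvGlue]
  exact expNegInvGlue.monotone (neg_le_neg h)

lemma alpha_of_nonneg {s : ℝ} (h : 0 ≤ s) : alpha s = 0 := if_neg (not_lt.2 h)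

lemma alpha_pos {s : ℝ} (h : s < 0) : 0 < alpha s := by
  rw [alpha, if_pos h]; exact Real.exp_pos _

/-- The coordinate `x_{(n+2)/2}`, on which alone the metric depends. It plays the part of a time
variable. -/
def time {n : ℕ} (x : E n) : ℝ := coord x ((n + 2) / 2)

/-- The zero-based position of the time coordinate. -/
def timeIdx {n : ℕ} (hn : 4 ≤ n) : Fin n := ⟨n / 2, by omega⟩

lemma time_eq {n : ℕ} (hn : 4 ≤ n) (x : E n) : time x = x (timeIdx hn) := by
  unfold time coord timeIdx
  rw [dif_pos (by omega)]
  exact congrArg x.ofLp (Fin.ext (show (n + 2) / 2 - 1 = n / 2 by omega))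

lemma continuous_time {n : ℕ} (hn : 4 ≤ n) : Continuous (time : E n → ℝ) := by
  have : (time : E n → ℝ) = fun x => x (timeIdx hn) := funext (time_eq hn)
  rw [this]
  fun_prop

/-- The action on (co)vectors of the off-diagonal part of the cometric: the involution
`i ↦ n + 1 - i` of the positions `1, …, n`, with the two middle positions annihilated. -/
def couple {n : ℕ} (v : Fin n → ℝ) : Fin n → ℝ := fun i =>
  if i.val + 1 = n / 2 ∨ i.val = n / 2 then 0 else v i.rev

lemma coupled_iff {n : ℕ} (hn : 4 ≤ n) (he : Even n) (i k : Fin n) :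
    Coupled n i k ↔ ¬ (i.val + 1 = n / 2 ∨ i.val = n / 2) ∧ k = i.rev := by
  obtain ⟨m, rfl⟩ := he
  have := i.2
  have := k.2
  rw [Fin.ext_iff, Fin.val_rev]
  constructor
  · rintro ⟨j, h⟩
    omega
  · rintro ⟨h1, h2⟩
    rcases lt_or_ge i.val (m - 1) with h | h
    · exact ⟨m - 1 - i.val, by omega⟩
    · exact ⟨i.val - m, by omega⟩

lemma cometric_mulVec {n : ℕ} (hn : 4 ≤ n) (he : Even n) (x : E n) (v : Fin n → ℝ) :
    cometric x *ᵥ v = v + alpha (time x) • couple v := by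
  classical
  ext i
  simp only [Matrix.mulVec, dotProduct, cometric, Matrix.of_apply, add_mul, Finset.sum_add_distrib,
    Pi.add_apply, Pi.smul_apply, smul_eq_mul, couple, time]
  congr 1
  · simp
  · simp only [coupled_iff hn he, mul_assoc, ← Finset.mul_sum]
    congr 1
    split_ifs with h <;> simp [h]

lemma cometric_isSymm {n : ℕ} (x : E n) : (cometric x)ᵀ = cometric x :=
  (Matrix.isHermitian_iff_isSymm.1 (cometric_posDef x).1)

lemma cometric_det_isUnit {n : ℕ} (x : E n) : IsUnit (cometric x).det :=
  (cometric_posDef x).det_pos.ne'.isUnit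

lemma cometric_mulVec_metric {n : ℕ} (x : E n) (v : Fin n → ℝ) :
    cometric x *ᵥ (metric x *ᵥ v) = v := by
  rw [Matrix.mulVec_mulVec, metric, Matrix.mul_nonsing_inv _ (cometric_det_isUnit x),
    Matrix.one_mulVec]

lemma dotProduct_cometric_comm {n : ℕ} (x : E n) (v w : Fin n → ℝ) :
    v ⬝ᵥ (cometric x *ᵥ w) = w ⬝ᵥ (cometric x *ᵥ v) := by
  rw [Matrix.dotProduct_mulVec, ← Matrix.mulVec_transpose, cometric_isSymm, dotProduct_comm]

lemma cometric_nonneg {n : ℕ} (x : E n) (v : Fin n → ℝ) : 0 ≤ v ⬝ᵥ (cometric x *ᵥ v) := by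
  simpa using (cometric_posDef x).posSemidef.dotProduct_mulVec_nonneg v

lemma metric_nonneg {n : ℕ} (x : E n) (v : Fin n → ℝ) : 0 ≤ v ⬝ᵥ (metric x *ᵥ v) := by
  simpa using (metric_posDef x).posSemidef.dotProduct_mulVec_nonneg v

/-- The metric evaluated on `v = G w`, with `G` the cometric, is the cometric evaluated on `w`. -/
lemma metric_eq_cometric {n : ℕ} (x : E n) (v : Fin n → ℝ) :
    v ⬝ᵥ (metric x *ᵥ v) = (metric x *ᵥ v) ⬝ᵥ (cometric x *ᵥ (metric x *ᵥ v)) := by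
  rw [cometric_mulVec_metric, dotProduct_comm]

/-- The Cauchy–Schwarz inequality between covectors and vectors. -/
lemma abs_dotProduct_le {n : ℕ} (x v : E n) (z : Fin n → ℝ) :
    |z ⬝ᵥ (v : Fin n → ℝ)| ≤ √ (z ⬝ᵥ (cometric x *ᵥ z)) * tangentLength x v := by
  set w := metric x *ᵥ (v : Fin n → ℝ) with hw
  have hGw : cometric x *ᵥ w = (v : Fin n → ℝ) := cometric_mulVec_metric x _
  have key : ∀ s : ℝ, 0 ≤ ((v : Fin n → ℝ) ⬝ᵥ w) * (s * s) + (2 * (z ⬝ᵥ (v : Fin n → ℝ))) * s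
      + z ⬝ᵥ (cometric x *ᵥ z) := by
    intro s
    have h := cometric_nonneg x (z + s • w)
    rw [Matrix.mulVec_add, Matrix.mulVec_smul, add_dotProduct, dotProduct_add, dotProduct_add,
      smul_dotProduct, smul_dotProduct, dotProduct_smul, dotProduct_smul,
      dotProduct_cometric_comm x w z, hGw, dotProduct_comm w] at h
    simp only [smul_eq_mul] at h
    linarith
  have hd := discrim_le_zero key
  rw [discrim] at hd
  rw [tangentLength, ← Real.sqrt_mul (cometric_nonneg x z), ← hw]
  apply Real.abs_le_sqrt
  nlinarith

lemma tangentLength_sq {n : ℕ} (x v : E n) :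
    tangentLength x v ^ 2 = (v : Fin n → ℝ) ⬝ᵥ (metric x *ᵥ (v : Fin n → ℝ)) :=
  Real.sq_sqrt (metric_nonneg x _)

lemma tangentLength_nonneg {n : ℕ} (x v : E n) : 0 ≤ tangentLength x v := Real.sqrt_nonneg _

lemma tangentLength_smul {n : ℕ} (x v : E n) (c : ℝ) :
    tangentLength x (c • v) = |c| * tangentLength x v := by
  have : ((c • v : E n) : Fin n → ℝ) = c • (v : Fin n → ℝ) := rfl
  rw [tangentLength, this, Matrix.mulVec_smul, smul_dotProduct, dotProduct_smul, smul_smul,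
    smul_eq_mul, Real.sqrt_mul (mul_self_nonneg c), Real.sqrt_mul_self_eq_abs, tangentLength]

/-- If `v = G z + h`, with `G` the cometric, then `|v|² = ⟨z, G z⟩ + 2 ⟨z, h⟩ + |h|²`. -/
lemma tangentLength_sq_add {n : ℕ} (x v h : E n) (z : Fin n → ℝ)
    (hv : (v : Fin n → ℝ) = cometric x *ᵥ z + (h : Fin n → ℝ)) :
    tangentLength x v ^ 2 = z ⬝ᵥ (cometric x *ᵥ z) + 2 * (z ⬝ᵥ (h : Fin n → ℝ))
      + tangentLength x h ^ 2 := by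
  have hz : metric x *ᵥ (cometric x *ᵥ z) = z := by
    rw [Matrix.mulVec_mulVec, metric, Matrix.nonsing_inv_mul _ (cometric_det_isUnit x),
      Matrix.one_mulVec]
  have hsym : (cometric x *ᵥ z) ⬝ᵥ (metric x *ᵥ (h : Fin n → ℝ)) = z ⬝ᵥ (h : Fin n → ℝ) := by
    rw [dotProduct_comm, dotProduct_cometric_comm, cometric_mulVec_metric]
  rw [tangentLength_sq, tangentLength_sq, hv, Matrix.mulVec_add, hz, add_dotProduct, dotProduct_add,
    dotProduct_add, hsym, dotProduct_comm _ z, dotProduct_comm (h : Fin n → ℝ) z]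
  ring

lemma dotProduct_self_eq_norm_sq {n : ℕ} (v : E n) :
    (v : Fin n → ℝ) ⬝ᵥ (v : Fin n → ℝ) = ‖v‖ ^ 2 := by
  rw [EuclideanSpace.real_norm_sq_eq, dotProduct]
  exact Finset.sum_congr rfl fun i _ => (sq _).symm

lemma abs_dotProduct_le_norm {n : ℕ} (v w : E n) :
    |(v : Fin n → ℝ) ⬝ᵥ (w : Fin n → ℝ)| ≤ ‖v‖ * ‖w‖ := by
  have h : (v : Fin n → ℝ) ⬝ᵥ (w : Fin n → ℝ) = inner ℝ w v := by
    rw [EuclideanSpace.inner_eq_star_dotProduct]; simp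
  rw [h, mul_comm]
  exact abs_real_inner_le_norm w v

lemma couple_dotProduct_le {n : ℕ} (v : Fin n → ℝ) : -(v ⬝ᵥ v) ≤ v ⬝ᵥ couple v := by
  have hrev : ∑ i : Fin n, v i.rev ^ 2 = ∑ i, v i ^ 2 :=
    Equiv.sum_comp Fin.revPerm fun i => v i ^ 2
  have h : ∀ i : Fin n, -(v i ^ 2 / 2 + v i.rev ^ 2 / 2) ≤ v i * couple v i := by
    intro i
    unfold couple
    split_ifs
    · nlinarith [sq_nonneg (v i), sq_nonneg (v i.rev)]
    · nlinarith [sq_nonneg (v i + v i.rev)]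
  have h2 := Finset.sum_le_sum fun i (_ : i ∈ Finset.univ) => h i
  simp only [Finset.sum_neg_distrib, Finset.sum_add_distrib, ← Finset.sum_div, hrev] at h2
  have h3 : v ⬝ᵥ v = ∑ i, v i ^ 2 := Finset.sum_congr rfl fun i _ => (sq _).symm
  rw [h3]
  unfold dotProduct
  linarith

/-- The metric is bounded by a multiple of the Euclidean one on each half space `t ≥ -R`. -/
lemma tangentLength_le_of_time_ge {n : ℕ} (hn : 4 ≤ n) (he : Even n) {R : ℝ} (x v : E n)
    (hx : -R ≤ time x) : tangentLength x v ≤ ‖v‖ / √ (1 - alpha (-R)) := by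
  set w : E n := WithLp.toLp 2 (metric x *ᵥ (v : Fin n → ℝ)) with hw
  have hα : alpha (time x) ≤ alpha (-R) := alpha_antitone hx
  have h1 : 0 < 1 - alpha (-R) := sub_pos.2 (alpha_lt_one _)
  have hQ : tangentLength x v ^ 2 = (v : Fin n → ℝ) ⬝ᵥ (w : Fin n → ℝ) := tangentLength_sq x v
  have hQ' : tangentLength x v ^ 2 = (w : Fin n → ℝ) ⬝ᵥ (cometric x *ᵥ (w : Fin n → ℝ)) := by
    rw [tangentLength_sq, metric_eq_cometric]
  rw [cometric_mulVec hn he, dotProduct_add, dotProduct_smul, dotProduct_self_eq_norm_sq,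
    smul_eq_mul] at hQ'
  have hc := couple_dotProduct_le (w : Fin n → ℝ)
  rw [dotProduct_self_eq_norm_sq] at hc
  have hvw := (le_abs_self _).trans (abs_dotProduct_le_norm v w)
  have h0 := alpha_nonneg (time x)
  have hlow : (1 - alpha (-R)) * ‖w‖ ^ 2 ≤ tangentLength x v ^ 2 := by
    nlinarith [mul_le_mul_of_nonneg_left hc h0, sq_nonneg ‖w‖]
  have hT := tangentLength_nonneg x v
  rw [le_div_iff₀ (Real.sqrt_pos.2 h1)]
  refine abs_le_of_sq_le_sq' ?_ (norm_nonneg v) |>.2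
  rw [mul_pow, Real.sq_sqrt h1.le]
  rcases (sq_nonneg (tangentLength x v)).eq_or_lt with h | h
  · rw [← h, zero_mul]; positivity
  · have h2 : (tangentLength x v ^ 2) ^ 2 ≤ ‖v‖ ^ 2 * ‖w‖ ^ 2 := by
      rw [← mul_pow]; exact pow_le_pow_left₀ h.le (hQ ▸ hvw) 2
    by_contra hcon
    push Not at hcon
    nlinarith [mul_lt_mul_of_pos_left hcon h, mul_le_mul_of_nonneg_left hlow (sq_nonneg ‖v‖),
      mul_le_mul_of_nonneg_left h2 h1.le]

/-! ### The Riemannian distance -/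

/-- The Riemannian distance with values in `[0, ∞]`. -/
def redist {n : ℕ} (x y : E n) : ℝ≥0∞ :=
  @Manifold.riemannianEDist (E n) _ _ (E n) _ 𝓘(ℝ, E n) (E n) _ _ (tangentENorm n) x y

lemma rdist_eq_toReal {n : ℕ} (x y : E n) : rdist x y = (redist x y).toReal := rfl

lemma tangentENorm_smulClass (n : ℕ) (x : E n) :
    @ENormSMulClass ℝ (TangentSpace 𝓘(ℝ, E n) x) _ (tangentENorm n x) _ := by
  let _ := tangentENorm n x
  refine ⟨fun c v => ?_⟩
  change ENNReal.ofReal (tangentLength x (c • (show E n from v)))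
    = ‖c‖ₑ * ENNReal.ofReal (tangentLength x (show E n from v))
  rw [tangentLength_smul, ENNReal.ofReal_mul (abs_nonneg c), ← Real.norm_eq_abs,
    ofReal_norm]

lemma redist_comm {n : ℕ} (x y : E n) : redist x y = redist y x := by
  let _ := tangentENorm n
  have := tangentENorm_smulClass n
  exact Manifold.riemannianEDist_comm

lemma redist_triangle {n : ℕ} (x y z : E n) : redist x z ≤ redist x y + redist y z := by
  let _ := tangentENorm n
  have := tangentENorm_smulClass n
  exact Manifold.riemannianEDist_triangle

lemma redist_le_of_speed_le {n : ℕ} {γ γ' : ℝ → E n} {a b K : ℝ} (hab : a ≤ b)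
    (hγ : ∀ t, HasDerivAt γ (γ' t) t) (hγ' : Continuous γ')
    (hK : ∀ t ∈ Set.Icc a b, tangentLength (γ t) (γ' t) ≤ K) :
    redist (γ a) (γ b) ≤ ENNReal.ofReal (K * (b - a)) := by
  let _ := tangentENorm n
  have := tangentENorm_smulClass n
  have hd : deriv γ = γ' := funext fun t => (hγ t).deriv
  have hC : ContDiff ℝ 1 γ :=
    contDiff_one_iff_deriv.2 ⟨fun t => (hγ t).differentiableAt, hd ▸ hγ'⟩
  have h := Manifold.riemannianEDist_le_pathELength (I := 𝓘(ℝ, E n)) (γ := γ) (a := a) (b := b)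
    hC.contMDiff.contMDiffOn rfl rfl hab
  refine h.trans ?_
  rw [Manifold.pathELength_eq_lintegral_mfderiv_Icc]
  calc ∫⁻ t in Set.Icc a b, ENNReal.ofReal (tangentLength (γ t)
          (show E n from mfderiv 𝓘(ℝ, ℝ) 𝓘(ℝ, E n) γ t 1))
      ≤ ∫⁻ t in Set.Icc a b, ENNReal.ofReal K := by
        refine setLIntegral_mono' measurableSet_Icc fun t ht => ENNReal.ofReal_le_ofReal ?_
        have : (show E n from mfderiv 𝓘(ℝ, ℝ) 𝓘(ℝ, E n) γ t 1) = γ' t := by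
          rw [mfderiv_eq_fderiv]
          exact (fderiv_apply_one_eq_deriv (𝕜 := ℝ) (f := γ) (x := t)).trans (hγ t).deriv
        rw [this]
        exact hK t ht
    _ = ENNReal.ofReal (K * (b - a)) := by
        have hn : a ∈ Set.Icc a b := ⟨le_rfl, hab⟩
        rw [setLIntegral_const, Real.volume_Icc,
          ENNReal.ofReal_mul ((tangentLength_nonneg _ _).trans (hK a hn))]

/-- A linear function whose differential `z` has the same length `L` at every point grows along a
path at most by `L` times the length of the path. -/
lemma abs_dotProduct_sub_le_redist {n : ℕ} (z : Fin n → ℝ) {L : ℝ}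
    (hz : ∀ x : E n, z ⬝ᵥ (cometric x *ᵥ z) = L ^ 2) (hL : 0 < L) (x y : E n) :
    ENNReal.ofReal (z ⬝ᵥ ((y - x : E n) : Fin n → ℝ) / L) ≤ redist x y := by
  let _ := tangentENorm n
  have := tangentENorm_smulClass n
  refine le_of_forall_gt fun r hr => ?_
  obtain ⟨γ, rfl, rfl, hγ, hlen, -, -⟩ :=
    Manifold.exists_lt_locally_constant_of_riemannianEDist_lt (I := 𝓘(ℝ, E n)) hr zero_lt_one
  refine lt_of_le_of_lt ?_ hlen
  have hC : ContDiff ℝ 1 γ := hγ.contDiff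
  have hγ' : ∀ t, HasDerivAt γ (deriv γ t) t := fun t =>
    (hC.differentiable one_ne_zero t).hasDerivAt
  have hcont : Continuous (deriv γ) := hC.continuous_deriv le_rfl
  set ℓ : E n →L[ℝ] ℝ := innerSL ℝ (WithLp.toLp 2 (L⁻¹ • z) : E n) with hℓ
  have hℓv : ∀ v : E n, ℓ v = z ⬝ᵥ (v : Fin n → ℝ) / L := fun v => by
    rw [hℓ, innerSL_apply_apply, EuclideanSpace.inner_eq_star_dotProduct, star_trivial,
      dotProduct_smul, dotProduct_comm, smul_eq_mul]
    field_simp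
  have hFTC : ∫ t in (0 : ℝ)..1, ℓ (deriv γ t) = ℓ (γ 1) - ℓ (γ 0) :=
    intervalIntegral.integral_eq_sub_of_hasDerivAt
      (f := fun t => ℓ (γ t)) (fun t _ => ℓ.hasFDerivAt.comp_hasDerivAt t (hγ' t))
      ((ℓ.continuous.comp hcont).intervalIntegrable _ _)
  rw [← hℓv, map_sub, ← hFTC, intervalIntegral.integral_of_le zero_le_one]
  rw [Manifold.pathELength_eq_lintegral_mfderiv_Icc, restrict_Ioc_eq_restrict_Icc]
  refine (ENNReal.ofReal_le_ofReal (le_abs_self _)).trans ?_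
  rw [← Real.norm_eq_abs, ofReal_norm]
  refine (enorm_integral_le_lintegral_enorm _).trans (lintegral_mono fun t => ?_)
  have ht : (show E n from mfderiv 𝓘(ℝ, ℝ) 𝓘(ℝ, E n) γ t 1) = deriv γ t := by
    rw [mfderiv_eq_fderiv]
    exact fderiv_apply_one_eq_deriv (𝕜 := ℝ) (f := γ) (x := t)
  change _ ≤ ENNReal.ofReal (tangentLength (γ t)
    (show E n from mfderiv 𝓘(ℝ, ℝ) 𝓘(ℝ, E n) γ t 1))
  rw [ht, ← ofReal_norm]
  refine ENNReal.ofReal_le_ofReal ?_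
  have := abs_dotProduct_le (γ t) (deriv γ t) z
  rw [hz, Real.sqrt_sq hL.le] at this
  rw [hℓv, Real.norm_eq_abs, abs_div, abs_of_pos hL, div_le_iff₀ hL, mul_comm]
  exact this

lemma redist_le_norm_sub {n : ℕ} (hn : 4 ≤ n) (he : Even n) {R : ℝ} {x y : E n}
    (hx : -R ≤ time x) (hy : -R ≤ time y) :
    redist x y ≤ ENNReal.ofReal (‖y - x‖ / √ (1 - alpha (-R))) := by
  have hγ : ∀ t : ℝ, HasDerivAt (fun t : ℝ => x + t • (y - x)) (y - x) t := fun t => by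
    simpa using ((hasDerivAt_id t).smul_const (y - x)).const_add x
  have h := redist_le_of_speed_le (γ := fun t : ℝ => x + t • (y - x)) (γ' := fun _ => y - x)
    (K := ‖y - x‖ / √ (1 - alpha (-R))) zero_le_one hγ continuous_const
    (fun t ht => tangentLength_le_of_time_ge hn he _ _ ?_)
  · simpa using h
  · rw [time_eq hn] at *
    simp only [PiLp.add_apply, PiLp.smul_apply, PiLp.sub_apply, smul_eq_mul]
    nlinarith [mul_nonneg ht.1 (neg_le_iff_add_nonneg.1 hy),
      mul_nonneg (sub_nonneg.2 ht.2) (neg_le_iff_add_nonneg.1 hx)]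

lemma redist_ne_top {n : ℕ} (hn : 4 ≤ n) (he : Even n) (x y : E n) : redist x y ≠ ⊤ := by
  refine ne_top_of_le_ne_top ENNReal.ofReal_ne_top
    (redist_le_norm_sub hn he (R := |time x| + |time y|) ?_ ?_)
  · linarith [neg_abs_le (time x), abs_nonneg (time y)]
  · linarith [neg_abs_le (time y), abs_nonneg (time x)]

lemma rdist_comm {n : ℕ} (x y : E n) : rdist x y = rdist y x := by
  rw [rdist_eq_toReal, redist_comm, ← rdist_eq_toReal]

lemma rdist_triangle {n : ℕ} (hn : 4 ≤ n) (he : Even n) (x y z : E n) :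
    rdist x z ≤ rdist x y + rdist y z := by
  simp only [rdist_eq_toReal]
  rw [← ENNReal.toReal_add (redist_ne_top hn he _ _) (redist_ne_top hn he _ _)]
  exact ENNReal.toReal_mono
    (ENNReal.add_ne_top.2 ⟨redist_ne_top hn he _ _, redist_ne_top hn he _ _⟩)
    (redist_triangle x y z)

lemma tendsto_rdist_nhds {n : ℕ} (hn : 4 ≤ n) (he : Even n) (x₀ : E n) :
    Filter.Tendsto (fun x => rdist x x₀) (𝓝 x₀) (𝓝 0) := by
  set R := |time x₀| + 1 with hR
  have hev : ∀ᶠ x in 𝓝 x₀, -R < time x :=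
    (continuous_time hn).continuousAt.eventually_const_lt (by
      rw [hR]; linarith [neg_abs_le (time x₀)])
  have hlim : Filter.Tendsto (fun x => ‖x₀ - x‖ / √ (1 - alpha (-R))) (𝓝 x₀) (𝓝 0) := by
    have : Continuous fun x => ‖x₀ - x‖ / √ (1 - alpha (-R)) := by fun_prop
    simpa using this.tendsto x₀
  refine squeeze_zero' (.of_forall fun x => ENNReal.toReal_nonneg) ?_ hlim
  filter_upwards [hev] with x hx
  refine ENNReal.toReal_le_of_le_ofReal (by positivity) (redist_le_norm_sub hn he hx.le ?_)
  rw [hR]; linarith [neg_abs_le (time x₀)]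

lemma continuous_rdist {n : ℕ} (hn : 4 ≤ n) (he : Even n) :
    Continuous fun z : E n × E n => rdist z.1 z.2 := by
  rw [continuous_iff_continuousAt]
  rintro ⟨x₀, y₀⟩
  rw [ContinuousAt, tendsto_iff_dist_tendsto_zero]
  have h1 := (tendsto_rdist_nhds hn he x₀).comp (continuous_fst.tendsto (x₀, y₀))
  have h2 := (tendsto_rdist_nhds hn he y₀).comp (continuous_snd.tendsto (x₀, y₀))
  have h := h1.add h2
  rw [add_zero] at h
  refine squeeze_zero (fun _ => dist_nonneg) (fun z => ?_) h
  simp only [Function.comp_apply]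
  rw [Real.dist_eq, abs_sub_le_iff]
  have a1 := rdist_triangle hn he z.1 x₀ z.2
  have a2 := rdist_triangle hn he x₀ y₀ z.2
  have a3 := rdist_triangle hn he x₀ z.1 y₀
  have a4 := rdist_triangle hn he z.1 z.2 y₀
  rw [rdist_comm y₀] at a2
  rw [rdist_comm x₀ z.1] at a3
  exact ⟨by linarith, by linarith⟩

/-! ### Geodesics and the phase -/

/-- The primitive of `α` that vanishes for `t ≥ 0`. -/
def alphaInt (t : ℝ) : ℝ := ∫ s in (0 : ℝ)..t, alpha s

lemma hasDerivAt_alphaInt (t : ℝ) : HasDerivAt alphaInt (alpha t) t :=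
  intervalIntegral.integral_hasDerivAt_right (continuous_alpha.intervalIntegrable _ _)
    (continuous_alpha.stronglyMeasurableAtFilter _ _) continuous_alpha.continuousAt

lemma alphaInt_of_nonneg {t : ℝ} (ht : 0 ≤ t) : alphaInt t = 0 := by
  rw [alphaInt, intervalIntegral.integral_congr (g := fun _ => 0) fun s hs => ?_]
  · simp
  · rw [Set.uIcc_of_le ht] at hs
    exact alpha_of_nonneg hs.1

lemma alphaInt_neg {t : ℝ} (ht : t < 0) : alphaInt t < 0 := by
  rw [alphaInt, intervalIntegral.integral_symm, neg_lt_zero]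
  refine intervalIntegral.intervalIntegral_pos_of_pos_on
    (continuous_alpha.intervalIntegrable _ _) (fun s hs => alpha_pos hs.2) ht

lemma alphaInt_mono : Monotone alphaInt :=
  monotone_of_hasDerivAt_nonneg (fun t => hasDerivAt_alphaInt t) fun t => alpha_nonneg t

lemma abs_alphaInt_le (t : ℝ) : |alphaInt t| ≤ |t| := by
  have := intervalIntegral.norm_integral_le_of_norm_le_const (a := 0) (b := t) (f := alpha) (C := 1)
    fun s _ => by
      rw [Real.norm_eq_abs, abs_of_nonneg (alpha_nonneg s)]; exact (alpha_lt_one s).le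
  simpa [alphaInt] using this

/-- The curve `t ↦ t z + (∫₀ᵗ α) P z`, with `I + α P` the cometric. If `z` has time
coordinate `1` and `⟨z, P z⟩ = 0`, this is the geodesic through the origin with momentum
proportional to `z`, parametrized by the time coordinate. -/
def ray {n : ℕ} (z : Fin n → ℝ) (t : ℝ) : Fin n → ℝ := t • z + alphaInt t • couple z

lemma hasDerivAt_ray {n : ℕ} (z : Fin n → ℝ) (t : ℝ) :
    HasDerivAt (ray z) (z + alpha t • couple z) t := by
  have h := ((hasDerivAt_id t).smul_const z).add
    ((hasDerivAt_alphaInt t).smul_const (couple z))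
  rw [one_smul] at h
  exact h

/-- The momenta used below: covectors with time component `1` whose length does not depend on the
point. -/
structure IsMomentum {n : ℕ} (hn : 4 ≤ n) (z : Fin n → ℝ) : Prop where
  time_eq_one : z (timeIdx hn) = 1
  dotProduct_couple : z ⬝ᵥ couple z = 0

lemma couple_timeIdx {n : ℕ} (hn : 4 ≤ n) (z : Fin n → ℝ) : couple z (timeIdx hn) = 0 := by
  simp [couple, timeIdx]

lemma IsMomentum.ray_time {n : ℕ} {hn : 4 ≤ n} {z : Fin n → ℝ} (hz : IsMomentum hn z) (t : ℝ) :
    ray z t (timeIdx hn) = t := by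
  simp [ray, hz.time_eq_one, couple_timeIdx]

lemma IsMomentum.dotProduct_ray {n : ℕ} {hn : 4 ≤ n} {z : Fin n → ℝ} (hz : IsMomentum hn z)
    (t : ℝ) : z ⬝ᵥ ray z t = t * (z ⬝ᵥ z) := by
  rw [ray, dotProduct_add, dotProduct_smul, dotProduct_smul, hz.dotProduct_couple]
  simp

/-- The Euclidean length of a covector. -/
def momentumNorm {n : ℕ} (z : Fin n → ℝ) : ℝ := √ (z ⬝ᵥ z)

lemma IsMomentum.one_le_norm {n : ℕ} {hn : 4 ≤ n} {z : Fin n → ℝ} (hz : IsMomentum hn z) :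
    1 ≤ momentumNorm z := by
  rw [momentumNorm, Real.one_le_sqrt, dotProduct]
  refine le_trans ?_ (Finset.single_le_sum (fun i _ => mul_self_nonneg (z i))
    (Finset.mem_univ (timeIdx hn)))
  simp [hz.time_eq_one]

lemma momentumNorm_sq {n : ℕ} (z : Fin n → ℝ) : momentumNorm z ^ 2 = z ⬝ᵥ z :=
  Real.sq_sqrt (Finset.sum_nonneg fun i _ => mul_self_nonneg (z i))

lemma IsMomentum.cometric_eq {n : ℕ} {hn : 4 ≤ n} (he : Even n) {z : Fin n → ℝ}
    (hz : IsMomentum hn z) (x : E n) : z ⬝ᵥ (cometric x *ᵥ z) = momentumNorm z ^ 2 := by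
  rw [cometric_mulVec hn he, dotProduct_add, dotProduct_smul, hz.dotProduct_couple,
    momentumNorm_sq]
  simp

/-- The linear phase `x ↦ ⟨z, x⟩ / |z|`, a solution of the eikonal equation if `z` is one of the
momenta above. -/
def phase {n : ℕ} (z : Fin n → ℝ) (x : E n) : ℝ := z ⬝ᵥ (x : Fin n → ℝ) / momentumNorm z

lemma IsMomentum.phase_sub_le_rdist {n : ℕ} {hn : 4 ≤ n} (he : Even n) {z : Fin n → ℝ}
    (hz : IsMomentum hn z) (x y : E n) : phase z x - phase z y ≤ rdist x y := by
  have h := abs_dotProduct_sub_le_redist z (hz.cometric_eq he)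
    (zero_lt_one.trans_le hz.one_le_norm) y x
  rw [ENNReal.ofReal_le_iff_le_toReal (redist_ne_top hn he _ _), ← rdist_eq_toReal,
    rdist_comm] at h
  rw [phase, phase, ← sub_div, ← dotProduct_sub]
  exact h

/-- Along a tube of width `ρ` around one of the geodesics above, the distance equals the difference
of the linear phases up to `O(ρ²)`. The upper bound comes from the path from `y` to `x` which
differs from a translate of the geodesic by a linear function of time. -/
lemma IsMomentum.rdist_le_phase_sub {n : ℕ} {hn : 4 ≤ n} (he : Even n) {z : Fin n → ℝ}
    (hz : IsMomentum hn z) {R ρ : ℝ} {x y w : E n} (hxy : time y + 1 / 2 ≤ time x)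
    (hy : -R ≤ time y)
    (hx' : ‖x - w - WithLp.toLp 2 (ray z (time x))‖ ≤ ρ)
    (hy' : ‖y - w - WithLp.toLp 2 (ray z (time y))‖ ≤ ρ) :
    rdist x y ≤ phase z x - phase z y + 4 * ρ ^ 2 / (1 - alpha (-R)) := by
  set s := time y with hs
  set t := time x with ht
  have hst : 0 < t - s := by linarith
  have hL1 := hz.one_le_norm
  set L := momentumNorm z with hL
  set ux := x - w - WithLp.toLp 2 (ray z t) with hux
  set uy := y - w - WithLp.toLp 2 (ray z s) with huy
  set h : E n := (t - s)⁻¹ • (ux - uy) with hh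
  have hA : 0 < 1 - alpha (-R) := sub_pos.2 (alpha_lt_one _)
  have hux_t : ux (timeIdx hn) = - w (timeIdx hn) := by
    simp [hux, hz.ray_time, ht, time_eq hn]
  have huy_t : uy (timeIdx hn) = - w (timeIdx hn) := by
    simp [huy, hz.ray_time, hs, time_eq hn]
  have hh_t : h (timeIdx hn) = 0 := by simp [hh, hux_t, huy_t]
  have hsmul : (t - s) • h = ux - uy := by rw [hh, smul_inv_smul₀ hst.ne']
  -- the path, its end points and its speed
  set γ : ℝ → E n := fun τ => y + (WithLp.toLp 2 (ray z τ) - WithLp.toLp 2 (ray z s))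
    + (τ - s) • h with hγ
  have hγs : γ s = y := by simp [hγ]
  have hγt : γ t = x := by simp only [hγ, hsmul, hux, huy]; abel
  have hγd : ∀ τ, HasDerivAt γ (WithLp.toLp 2 (z + alpha τ • couple z) + h) τ := by
    intro τ
    have h1 : HasDerivAt (fun τ => (WithLp.toLp 2 (ray z τ) : E n))
        (WithLp.toLp 2 (z + alpha τ • couple z)) τ :=
      (PiLp.continuousLinearEquiv 2 ℝ (fun _ : Fin n => ℝ)).symm.hasFDerivAt.comp_hasDerivAt τ
        (hasDerivAt_ray z τ)
    have h2 : HasDerivAt (fun τ : ℝ => (τ - s) • h) h τ := by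
      simpa using ((hasDerivAt_id τ).sub_const s).smul_const h
    exact ((h1.sub_const _).const_add y).add h2
  have hγtime : ∀ τ, time (γ τ) = τ := by
    intro τ
    rw [time_eq hn]
    simp [hγ, hz.ray_time, hh_t, hs, time_eq hn]
  have hγcont : Continuous fun τ => (WithLp.toLp 2 (z + alpha τ • couple z) + h : E n) := by
    have := continuous_alpha
    fun_prop
  set Q := ‖h‖ ^ 2 / (1 - alpha (-R)) with hQ
  set P := z ⬝ᵥ (h : Fin n → ℝ) with hP
  have hspeed : ∀ τ ∈ Set.Icc s t,
      tangentLength (γ τ) (WithLp.toLp 2 (z + alpha τ • couple z) + h) ≤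
        L + P / L + Q / 2 := by
    intro τ hτ
    have hsq := tangentLength_sq_add (γ τ) (WithLp.toLp 2 (z + alpha τ • couple z) + h) h z
      (by rw [cometric_mulVec hn he, hγtime]; rfl)
    rw [hz.cometric_eq he, ← hL, ← hP] at hsq
    have hR := tangentLength_le_of_time_ge hn he (R := R) (γ τ) h
      (by rw [hγtime]; exact hy.trans hτ.1)
    have hR2 : tangentLength (γ τ) h ^ 2 ≤ Q := by
      refine (pow_le_pow_left₀ (tangentLength_nonneg _ _) hR 2).trans_eq ?_
      rw [div_pow, Real.sq_sqrt hA.le]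
    set l := tangentLength (γ τ) (WithLp.toLp 2 (z + alpha τ • couple z) + h)
    have hQ0 : 0 ≤ Q := by positivity
    -- `√(L² + u) ≤ L + u / (2 L)`
    have hlin : l ≤ L + (2 * P + Q) / (2 * L) := by
      have h1 : l * (2 * L) ≤ 2 * L ^ 2 + (2 * P + Q) := by nlinarith [sq_nonneg (l - L)]
      rw [← sub_le_iff_le_add', le_div_iff₀ (by positivity)]
      nlinarith
    have h3 : (2 * P + Q) / (2 * L) = P / L + Q / (2 * L) := by field_simp
    have h4 : Q / (2 * L) ≤ Q / 2 := by gcongr; linarith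
    linarith
  have hmain := redist_le_of_speed_le (by linarith) hγd hγcont hspeed
  rw [hγs, hγt, redist_comm] at hmain
  have hK0 : 0 ≤ L + P / L + Q / 2 :=
    (tangentLength_nonneg _ _).trans (hspeed s ⟨le_rfl, by linarith⟩)
  have hmain' : rdist x y ≤ (L + P / L + Q / 2) * (t - s) :=
    ENNReal.toReal_le_of_le_ofReal (by positivity) hmain
  have hphase : phase z x - phase z y = (L + P / L) * (t - s) := by
    have hdiff : ((x - y : E n) : Fin n → ℝ)
        = (ray z t - ray z s) + (t - s) • (h : Fin n → ℝ) := by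
      have : x - y = (WithLp.toLp 2 (ray z t) - WithLp.toLp 2 (ray z s)) + (t - s) • h := by
        rw [hsmul, hux, huy]; abel
      rw [this]; rfl
    rw [phase, phase, ← sub_div, ← dotProduct_sub, ← hL]
    have h1 : (x : Fin n → ℝ) - (y : Fin n → ℝ) = ((x - y : E n) : Fin n → ℝ) := rfl
    rw [h1, hdiff, dotProduct_add, dotProduct_sub, hz.dotProduct_ray, hz.dotProduct_ray,
      dotProduct_smul, ← momentumNorm_sq, ← hL, ← hP, smul_eq_mul]
    field_simp
  have hQt : Q / 2 * (t - s) ≤ 4 * ρ ^ 2 / (1 - alpha (-R)) := by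
    have hd : ‖ux - uy‖ ≤ 2 * ρ := (norm_sub_le _ _).trans (by linarith)
    have hn' : (t - s) * ‖h‖ ≤ 2 * ρ := by
      rw [← abs_of_pos hst, ← Real.norm_eq_abs, ← norm_smul, hsmul]; exact hd
    have h5 : ‖h‖ ^ 2 / 2 * (t - s) ≤ 4 * ρ ^ 2 := by
      have h6 : ((t - s) * ‖h‖) ^ 2 ≤ (2 * ρ) ^ 2 := pow_le_pow_left₀ (by positivity) hn' 2
      nlinarith [mul_nonneg (mul_nonneg hst.le (sq_nonneg ‖h‖))
        (by linarith : (0 : ℝ) ≤ t - s - 1 / 2)]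
    rw [hQ, le_div_iff₀ hA]
    refine le_trans (le_of_eq ?_) h5
    field_simp
  rw [hphase]
  linarith

/-! ### The Riemannian volume -/

lemma continuous_cometric_det {n : ℕ} (hn : 4 ≤ n) :
    Continuous fun x : E n => (cometric x).det := by
  refine Continuous.matrix_det (continuous_matrix fun i k => ?_)
  have h : Continuous fun x : E n => alpha (time x) := continuous_alpha.comp (continuous_time hn)
  exact continuous_const.add (h.mul continuous_const)

lemma continuous_density {n : ℕ} (hn : 4 ≤ n) :
    Continuous fun x : E n => √ (metric x).det := by
  have h : (fun x : E n => (metric x).det) = fun x => ((cometric x).det)⁻¹ := by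
    ext x
    rw [metric, Matrix.det_nonsing_inv, Ring.inverse_eq_inv']
  exact Real.continuous_sqrt.comp
    (h ▸ (continuous_cometric_det hn).inv₀ fun x => (cometric_posDef x).det_pos.ne')

lemma density_eq_one {n : ℕ} {x : E n} (hx : 0 ≤ time x) : √ (metric x).det = 1 := by
  have h : cometric x = 1 := by
    ext i k
    have : alpha (coord x ((n + 2) / 2)) = 0 := alpha_of_nonneg hx
    rw [cometric, Matrix.of_apply, this, zero_mul, add_zero, Matrix.one_apply]
  rw [metric, h]
  simp

lemma isLocallyFiniteMeasure_vol {n : ℕ} (hn : 4 ≤ n) : IsLocallyFiniteMeasure (vol n) :=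
  IsLocallyFiniteMeasure.withDensity_ofReal (continuous_density hn)

lemma vol_eq_volume {n : ℕ} {S : Set (E n)} (hS : MeasurableSet S) (h : ∀ x ∈ S, 0 ≤ time x) :
    vol n S = volume S := by
  rw [vol, withDensity_apply _ hS, setLIntegral_congr_fun (g := fun _ => 1) hS fun x hx => by
    simp [density_eq_one (h x hx)]]
  simp

lemma le_vol_of_le_density {n : ℕ} {S : Set (E n)} (hS : MeasurableSet S) {d : ℝ}
    (h : ∀ x ∈ S, d ≤ √ (metric x).det) : ENNReal.ofReal d * volume S ≤ vol n S := by
  rw [vol, withDensity_apply _ hS, ← setLIntegral_const]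
  exact setLIntegral_mono' hS fun x hx => ENNReal.ofReal_le_ofReal (h x hx)

/-! ### Tubes -/

/-- The volume of a curved tube with cubical cross sections is that of a straight one. -/
lemma volume_cubical_tube {n : ℕ} (T : Fin n) {c : ℝ → Fin n → ℝ} (hc : Continuous c) {a b ρ : ℝ}
    (hρ : 0 ≤ ρ) :
    volume {x : E n | x T ∈ Set.Icc a b ∧ ∀ i, i ≠ T → |x i - c (x T) i| ≤ ρ}
      = ENNReal.ofReal (b - a) * ENNReal.ofReal (2 * ρ) ^ (n - 1) := by
  obtain ⟨N, rfl⟩ : ∃ N, n = N + 1 := ⟨n - 1, by have := T.2; omega⟩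
  set S : Set (ℝ × (Fin N → ℝ)) := {p | p.1 ∈ Set.Icc a b ∧
    ∀ j, |p.2 j - c p.1 (T.succAbove j)| ≤ ρ} with hS
  have hSm : MeasurableSet S := by
    refine IsClosed.measurableSet ?_
    simp only [hS, Set.ofPred_and, Set.ofPred_forall]
    refine (isClosed_Icc.preimage continuous_fst).inter (isClosed_iInter fun j => ?_)
    exact isClosed_le (by fun_prop) continuous_const
  have hpre : {x : E (N + 1) | x T ∈ Set.Icc a b ∧ ∀ i, i ≠ T → |x i - c (x T) i| ≤ ρ}
      = WithLp.ofLp ⁻¹' (MeasurableEquiv.piFinSuccAbove (fun _ => ℝ) T ⁻¹' S) := by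
    ext x
    simp only [Set.mem_ofPred_eq, Set.mem_preimage, hS, MeasurableEquiv.piFinSuccAbove_apply]
    refine and_congr Iff.rfl ⟨fun h j => h _ (Fin.succAbove_ne T j), fun h i hi => ?_⟩
    obtain ⟨j, rfl⟩ := Fin.exists_succAbove_eq hi
    exact h j
  rw [hpre, (PiLp.volume_preserving_ofLp _).measure_preimage
      ((MeasurableEquiv.measurable _) hSm).nullMeasurableSet,
    (volume_preserving_piFinSuccAbove (fun _ => ℝ) T).measure_preimage hSm.nullMeasurableSet,
    Measure.volume_eq_prod, Measure.prod_apply hSm]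
  have hsec : ∀ t : ℝ, volume (Prod.mk t ⁻¹' S)
      = (Set.Icc a b).indicator (fun _ => ENNReal.ofReal (2 * ρ) ^ N) t := by
    intro t
    by_cases ht : t ∈ Set.Icc a b
    · have : Prod.mk t ⁻¹' S = Metric.closedBall (fun j => c t (T.succAbove j)) ρ := by
        ext u
        rw [mem_closedBall_iff_norm, pi_norm_le_iff_of_nonneg hρ]
        simp only [hS, Set.mem_preimage, Set.mem_ofPred_eq, ht, true_and, Real.norm_eq_abs,
          Pi.sub_apply]
      rw [this, Real.volume_pi_closedBall _ hρ, Set.indicator_of_mem ht, Fintype.card_fin,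
        ENNReal.ofReal_pow (by positivity)]
    · have : Prod.mk t ⁻¹' S = ∅ := by
        ext u
        simp only [hS, Set.mem_preimage, Set.mem_ofPred_eq, ht, false_and, Set.mem_empty_iff_false]
      rw [this, Set.indicator_of_notMem ht, measure_empty]
  simp_rw [hsec]
  rw [lintegral_indicator measurableSet_Icc, setLIntegral_const, Real.volume_Icc, mul_comm,
    Nat.add_sub_cancel]

/-- The momentum attached to the grid point `δ k`. Its components are the entries of `δ k` in the
positions after the time coordinate, moved to the positions coupled with them. -/
def gridMomentum {n : ℕ} (δ : ℝ) (k : Fin n → ℕ) : Fin n → ℝ := fun i =>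
  if i.val = n / 2 then 1 else if i.val + 1 < n / 2 then δ * k i.rev else 0

/-- The position at time `0` attached to the grid point `δ k`. Its components are the entries of
`δ k` in the positions before the time coordinate. -/
def gridPoint {n : ℕ} (δ : ℝ) (k : Fin n → ℕ) : E n :=
  WithLp.toLp 2 fun i => if i.val < n / 2 then δ * k i else 0

/-- The grid indices `k` with entries less than `M`. The entry in the time position plays no part
and is set to `0`. -/
def grid {n : ℕ} (hn : 4 ≤ n) (M : ℕ) : Finset (Fin n → ℕ) :=
  Fintype.piFinset fun i => if i = timeIdx hn then {0} else Finset.range M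

/-- The part over the times in `[a, b]` of the tube of width `ρ` around the geodesic with the
position and the momentum given by `δ k`. -/
def tube {n : ℕ} (hn : 4 ≤ n) (δ ρ a b : ℝ) (k : Fin n → ℕ) : Set (E n) :=
  {x | time x ∈ Set.Icc a b ∧ ∀ i, i ≠ timeIdx hn →
    |x i - (gridPoint δ k i + ray (gridMomentum δ k) (time x) i)| ≤ ρ}

lemma isMomentum_gridMomentum {n : ℕ} (hn : 4 ≤ n) (he : Even n) (δ : ℝ) (k : Fin n → ℕ) :
    IsMomentum hn (gridMomentum δ k) := by
  obtain ⟨m, rfl⟩ := he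
  refine ⟨by simp [gridMomentum, timeIdx], Finset.sum_eq_zero fun i _ => ?_⟩
  have hi := i.2
  unfold couple gridMomentum
  simp only [Fin.val_rev]
  split_ifs <;> first | omega | simp

lemma card_grid {n : ℕ} (hn : 4 ≤ n) (M : ℕ) : (grid hn M).card = M ^ (n - 1) := by
  classical
  rw [grid, Fintype.card_piFinset,
    ← Finset.mul_prod_erase _ _ (Finset.mem_univ (timeIdx hn)),
    Finset.prod_congr rfl (g := fun _ => M) fun i hi => by
      rw [if_neg (Finset.ne_of_mem_erase hi), Finset.card_range]]
  simp [Finset.card_erase_of_mem]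

lemma mem_grid {n : ℕ} {hn : 4 ≤ n} {M : ℕ} {k : Fin n → ℕ} (hk : k ∈ grid hn M) :
    k (timeIdx hn) = 0 ∧ ∀ i, i ≠ timeIdx hn → k i < M := by
  rw [grid, Fintype.mem_piFinset] at hk
  refine ⟨by simpa using hk (timeIdx hn), fun i hi => by simpa [hi] using hk i⟩

lemma ray_gridMomentum_of_lt {n : ℕ} (he : Even n) (δ : ℝ) (k : Fin n → ℕ) (t : ℝ)
    {i : Fin n} (hi : i.val < n / 2) :
    ray (gridMomentum δ k) t i = t * if i.val + 1 < n / 2 then δ * k i.rev else 0 := by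
  obtain ⟨m, rfl⟩ := he
  have h : couple (gridMomentum δ k) i = 0 := by
    unfold couple gridMomentum
    simp only [Fin.val_rev]
    split_ifs <;> first | omega | rfl
  simp only [ray, Pi.add_apply, Pi.smul_apply, smul_eq_mul, h, gridMomentum, if_neg hi.ne]
  ring

lemma ray_gridMomentum_of_gt {n : ℕ} (he : Even n) (δ : ℝ) (k : Fin n → ℕ) (t : ℝ)
    {i : Fin n} (hi : n / 2 < i.val) :
    ray (gridMomentum δ k) t i = alphaInt t * (δ * k i) := by
  obtain ⟨m, rfl⟩ := he
  have := i.2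
  have h : couple (gridMomentum δ k) i = δ * k i := by
    unfold couple gridMomentum
    simp only [Fin.val_rev, Fin.rev_rev]
    split_ifs <;> first | omega | rfl
  simp only [ray, Pi.add_apply, Pi.smul_apply, smul_eq_mul, h, gridMomentum, if_neg hi.ne']
  rw [if_neg (by omega)]
  ring

lemma gridPoint_of_gt {n : ℕ} (δ : ℝ) (k : Fin n → ℕ) {i : Fin n} (hi : n / 2 ≤ i.val) :
    gridPoint δ k i = 0 := by
  simp [gridPoint, not_lt.2 hi]

lemma gridPoint_of_lt {n : ℕ} (δ : ℝ) (k : Fin n → ℕ) {i : Fin n} (hi : i.val < n / 2) :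
    gridPoint δ k i = δ * k i := by
  simp [gridPoint, hi]

lemma val_ne_of_ne_timeIdx {n : ℕ} {hn : 4 ≤ n} {i : Fin n} (hi : i ≠ timeIdx hn) :
    i.val ≠ n / 2 := fun h => hi (Fin.ext h)

lemma continuous_ray {n : ℕ} (z : Fin n → ℝ) : Continuous (ray z) :=
  continuous_iff_continuousAt.2 fun t => (hasDerivAt_ray z t).continuousAt

lemma isClosed_tube {n : ℕ} (hn : 4 ≤ n) (δ ρ a b : ℝ) (k : Fin n → ℕ) :
    IsClosed (tube hn δ ρ a b k) := by
  have ht := continuous_time hn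
  have hr := (continuous_ray (gridMomentum δ k)).comp ht
  simp only [tube, Set.ofPred_and, Set.ofPred_forall]
  refine (isClosed_Icc.preimage ht).inter
    (isClosed_iInter fun i => isClosed_iInter fun _ => isClosed_le ?_ continuous_const)
  have := continuous_pi_iff.1 hr i
  simp only [Function.comp_apply] at this
  fun_prop

lemma volume_tube {n : ℕ} (hn : 4 ≤ n) (δ a b : ℝ) {ρ : ℝ} (hρ : 0 ≤ ρ) (k : Fin n → ℕ) :
    volume (tube hn δ ρ a b k) = ENNReal.ofReal (b - a) * ENNReal.ofReal (2 * ρ) ^ (n - 1) := by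
  rw [← volume_cubical_tube (timeIdx hn)
    (c := fun t i => gridPoint δ k i + ray (gridMomentum δ k) t i) (a := a) (b := b) _ hρ]
  · simp only [tube, time_eq hn]
  · have := continuous_ray (gridMomentum δ k)
    fun_prop

lemma norm_sub_ray_le_of_mem_tube {n : ℕ} {hn : 4 ≤ n} (he : Even n) {δ ρ a b : ℝ} (hρ : 0 ≤ ρ)
    {k : Fin n → ℕ} {x : E n} (hx : x ∈ tube hn δ ρ a b k) :
    ‖x - gridPoint δ k - WithLp.toLp 2 (ray (gridMomentum δ k) (time x))‖ ≤ √ n * ρ := by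
  refine abs_le_of_sq_le_sq' ?_ (by positivity) |>.2
  rw [EuclideanSpace.real_norm_sq_eq, mul_pow, Real.sq_sqrt (Nat.cast_nonneg n)]
  calc _ ≤ ∑ _i : Fin n, ρ ^ 2 := Finset.sum_le_sum fun i _ => ?_
    _ = n * ρ ^ 2 := by simp
  rw [← sq_abs]
  refine pow_le_pow_left₀ (abs_nonneg _) ?_ 2
  simp only [PiLp.sub_apply]
  rw [sub_sub]
  by_cases hi : i = timeIdx hn
  · subst hi
    rw [(isMomentum_gridMomentum hn he δ k).ray_time, gridPoint_of_gt δ k le_rfl, time_eq hn]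
    simpa using hρ
  · exact hx.2 i hi

lemma abs_le_of_mem_tube {n : ℕ} {hn : 4 ≤ n} (he : Even n) {δ ρ a b r : ℝ} {M : ℕ} (hδ : 0 ≤ δ)
    (hM : δ * M ≤ r) (hρ : ρ ≤ r) {k : Fin n → ℕ} (hk : k ∈ grid hn M) {x : E n}
    (hx : x ∈ tube hn δ ρ a b k) (ht : |time x| ≤ 1) {i : Fin n} (hi : i ≠ timeIdx hn) :
    |x i| ≤ 3 * r := by
  have hb : ∀ j, j ≠ timeIdx hn → 0 ≤ δ * k j ∧ δ * k j ≤ r := fun j hj =>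
    ⟨by positivity, le_trans (by have := (mem_grid hk).2 j hj; gcongr) hM⟩
  have hxi := hx.2 i hi
  have hr : 0 ≤ r := (hb i hi).1.trans (hb i hi).2
  have habs := abs_sub_abs_le_abs_sub (x i) (gridPoint δ k i + ray (gridMomentum δ k) (time x) i)
  have hcenter : |gridPoint δ k i + ray (gridMomentum δ k) (time x) i| ≤ 2 * r := by
    rcases lt_or_gt_of_ne (val_ne_of_ne_timeIdx hi) with h | h
    · rw [gridPoint_of_lt _ _ h, ray_gridMomentum_of_lt he _ _ _ h]
      refine (abs_add_le _ _).trans ?_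
      rw [abs_of_nonneg (hb i hi).1, abs_mul]
      split_ifs with h'
      · have hj : i.rev ≠ timeIdx hn := fun hj => by
          have := congrArg Fin.val hj
          obtain ⟨m, rfl⟩ := he
          simp only [Fin.val_rev, timeIdx] at this
          omega
        rw [abs_of_nonneg (hb _ hj).1]
        nlinarith [hb i hi, hb _ hj, abs_nonneg (time x)]
      · simp only [abs_zero, mul_zero]
        linarith [hb i hi]
    · rw [gridPoint_of_gt _ _ h.le, ray_gridMomentum_of_gt he _ _ _ h, zero_add, abs_mul,
        abs_of_nonneg (hb i hi).1]
      have := (abs_alphaInt_le (time x)).trans ht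
      nlinarith [hb i hi, abs_nonneg (alphaInt (time x))]
  linarith

/-- For nonnegative times the tubes lie in the neighbourhood of width `ρ` of a plane of
dimension `(n + 2) / 2`. -/
lemma abs_le_width_of_mem_tube {n : ℕ} {hn : 4 ≤ n} (he : Even n) {δ ρ a b : ℝ} (ha : 0 ≤ a)
    {k : Fin n → ℕ} {x : E n} (hx : x ∈ tube hn δ ρ a b k) {i : Fin n} (hi : n / 2 < i.val) :
    |x i| ≤ ρ := by
  have h := hx.2 i fun h => hi.ne' (congrArg Fin.val h)
  rwa [gridPoint_of_gt _ _ hi.le, ray_gridMomentum_of_gt he _ _ _ hi,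
    alphaInt_of_nonneg (ha.trans hx.1.1), zero_mul, zero_add, sub_zero] at h

lemma nat_eq_of_abs_mul_sub_le {δ ρ s : ℝ} {p q : ℕ} (h : |s * (δ * p) - s * (δ * q)| ≤ 2 * ρ)
    (hs : 2 * ρ < |s| * δ) : p = q := by
  by_contra hpq
  have hδ : 0 ≤ δ := by
    by_contra hδ
    nlinarith [abs_nonneg s, abs_nonneg (s * (δ * p) - s * (δ * q))]
  have h1 : (1 : ℝ) ≤ |(p : ℝ) - q| := by
    have : (1 : ℤ) ≤ |(p : ℤ) - q| := Int.one_le_abs (by omega)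
    exact_mod_cast this
  have h2 : |s * (δ * p) - s * (δ * q)| = |s| * δ * |(p : ℝ) - q| := by
    rw [← abs_of_nonneg hδ, ← abs_mul, ← abs_mul, abs_of_nonneg hδ]
    ring_nf
  nlinarith [mul_nonneg (abs_nonneg s) hδ]

/-- The tubes are disjoint for times close to `-1`, because there the coordinates after the time
coordinate determine the momentum. -/
lemma eq_of_mem_tube {n : ℕ} {hn : 4 ≤ n} (he : Even n) {δ ρ a b : ℝ} {M : ℕ} (hδ : 0 < δ)
    (hb : b ≤ -(1 / 2)) (hρ : 2 * ρ < -alphaInt (-(1 / 2)) * δ)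
    {k k' : Fin n → ℕ} (hk : k ∈ grid hn M) (hk' : k' ∈ grid hn M) {x : E n}
    (hx : x ∈ tube hn δ ρ a b k) (hx' : x ∈ tube hn δ ρ a b k') : k = k' := by
  have hβ : -alphaInt (-(1 / 2)) ≤ -alphaInt (time x) :=
    neg_le_neg (alphaInt_mono (hx.1.2.trans hb))
  have hβ1 : -alphaInt (-(1 / 2)) ≤ 1 := by
    have h := abs_alphaInt_le (-(1 / 2))
    rw [abs_neg, abs_of_pos (by norm_num : (0 : ℝ) < 1 / 2)] at h
    linarith [neg_abs_le (alphaInt (-(1 / 2)))]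
  have hdiff : ∀ i, i ≠ timeIdx hn →
      |(gridPoint δ k i + ray (gridMomentum δ k) (time x) i)
        - (gridPoint δ k' i + ray (gridMomentum δ k') (time x) i)| ≤ 2 * ρ := by
    intro i hi
    have h1 := hx.2 i hi
    have h2 := hx'.2 i hi
    rw [abs_le] at h1 h2 ⊢
    constructor <;> linarith
  have hgt : ∀ i : Fin n, n / 2 < i.val → k i = k' i := by
    intro i hi
    have h := hdiff i fun h => hi.ne' (congrArg Fin.val h)
    rw [gridPoint_of_gt _ _ hi.le, gridPoint_of_gt _ _ hi.le, ray_gridMomentum_of_gt he _ _ _ hi,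
      ray_gridMomentum_of_gt he _ _ _ hi, zero_add, zero_add] at h
    refine nat_eq_of_abs_mul_sub_le h (hρ.trans_le ?_)
    gcongr
    exact hβ.trans (neg_le_abs _)
  funext i
  rcases lt_trichotomy i.val (n / 2) with hi | hi | hi
  · have h := hdiff i fun h => hi.ne (congrArg Fin.val h)
    have hrev : (if i.val + 1 < n / 2 then δ * (k i.rev : ℝ) else 0)
        = if i.val + 1 < n / 2 then δ * (k' i.rev : ℝ) else 0 := by
      split_ifs with h'
      · rw [hgt i.rev (by
          obtain ⟨m, rfl⟩ := he
          rw [Fin.val_rev]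
          omega)]
      · rfl
    rw [gridPoint_of_lt _ _ hi, gridPoint_of_lt _ _ hi, ray_gridMomentum_of_lt he _ _ _ hi,
      ray_gridMomentum_of_lt he _ _ _ hi, hrev, add_sub_add_right_eq_sub] at h
    refine nat_eq_of_abs_mul_sub_le (s := 1) (δ := δ) (ρ := ρ) (by simpa using h) ?_
    rw [abs_one, one_mul]
    nlinarith
  · rw [show i = timeIdx hn from Fin.ext hi, (mem_grid hk).1, (mem_grid hk').1]
  · exact hgt i hi

/-- The neighbourhood of width `ρ` of a plane of dimension `(n + 2) / 2` into which the tubes are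
compressed for nonnegative times. -/
def slab (n : ℕ) (ρ : ℝ) : Set (E n) :=
  {x | 0 ≤ time x ∧ ∀ i : Fin n, |x i| ≤ if n / 2 < i.val then ρ else 1}

lemma isClosed_slab {n : ℕ} (hn : 4 ≤ n) (ρ : ℝ) : IsClosed (slab n ρ) := by
  simp only [slab, Set.ofPred_and, Set.ofPred_forall]
  refine (isClosed_le continuous_const (continuous_time hn)).inter
    (isClosed_iInter fun i => isClosed_le (by fun_prop) continuous_const)

lemma vol_slab_le {n : ℕ} (hn : 4 ≤ n) (he : Even n) {ρ : ℝ} (hρ : 0 ≤ ρ) :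
    vol n (slab n ρ) ≤ ENNReal.ofReal (2 ^ n * ρ ^ (n / 2 - 1)) := by
  rw [vol_eq_volume (isClosed_slab hn ρ).measurableSet fun x hx => hx.1]
  set w : Fin n → ℝ := fun i => if n / 2 < i.val then ρ else 1 with hw
  have hsub : slab n ρ ⊆ WithLp.ofLp ⁻¹' Set.Icc (-w) w := fun x hx =>
    ⟨fun i => (abs_le.1 (hx.2 i)).1, fun i => (abs_le.1 (hx.2 i)).2⟩
  refine (measure_mono hsub).trans_eq ?_
  rw [(PiLp.volume_preserving_ofLp _).measure_preimage measurableSet_Icc.nullMeasurableSet,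
    Real.volume_Icc_pi]
  have hw0 : ∀ i, 0 ≤ w i := fun i => by simp only [hw]; split_ifs <;> positivity
  rw [← ENNReal.ofReal_prod_of_nonneg fun i _ => by
    rw [Pi.neg_apply]; linarith [hw0 i]]
  congr 1
  have h2 : ∀ i, w i - (-w) i = 2 * w i := fun i => by rw [Pi.neg_apply]; ring
  simp only [h2, Finset.prod_mul_distrib, Finset.prod_const, Finset.card_univ, Fintype.card_fin]
  congr 1
  simp only [hw, Finset.prod_ite, Finset.prod_const, one_pow, mul_one]
  congr 1
  -- The entries after the time coordinate number `n - 1 - n / 2 = n / 2 - 1`.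
  have hcard : (Finset.univ.filter fun i : Fin n => n / 2 < i.val)
      = Finset.Ioi (timeIdx hn) := by
    ext i
    simp [Fin.lt_def, timeIdx]
  rw [hcard, Fin.card_Ioi]
  obtain ⟨m, rfl⟩ := he
  simp only [timeIdx]
  omega

/-! ### The oscillatory integral -/

/-- The integrand of the oscillatory integral. -/
def oscIntegrand {n : ℕ} (a : E n × E n → ℝ) (lam : ℝ) (f : E n → ℂ) (x y : E n) : ℂ :=
  Complex.exp (Complex.I * ((lam * rdist x y : ℝ) : ℂ)) * ((a (x, y) : ℝ) : ℂ) * f y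

lemma oscInt_eq {n : ℕ} (a : E n × E n → ℝ) (lam : ℝ) (f : E n → ℂ) (x : E n) :
    oscInt a lam f x = ∫ y, oscIntegrand a lam f x y ∂(vol n) := rfl

lemma norm_exp_I_mul (s : ℝ) : ‖Complex.exp (Complex.I * (s : ℂ))‖ = 1 := by
  rw [mul_comm, Complex.norm_exp_ofReal_mul_I]

lemma continuous_kernel {n : ℕ} (hn : 4 ≤ n) (he : Even n) {a : E n × E n → ℝ}
    (ha : Continuous a) (lam : ℝ) : Continuous fun z : E n × E n =>
      Complex.exp (Complex.I * ((lam * rdist z.1 z.2 : ℝ) : ℂ)) * ((a z : ℝ) : ℂ) := by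
  have := continuous_rdist hn he
  fun_prop

lemma integrable_oscIntegrand {n : ℕ} (hn : 4 ≤ n) (he : Even n) {a : E n × E n → ℝ}
    (ha : IsAmplitude a) (lam : ℝ) {f : E n → ℂ} (hf : Measurable f) {C : ℝ}
    (hC : ∀ y, ‖f y‖ ≤ C) (x : E n) : Integrable (oscIntegrand a lam f x) (vol n) := by
  have := isLocallyFiniteMeasure_vol hn
  set K : E n → ℂ := fun y =>
    Complex.exp (Complex.I * ((lam * rdist x y : ℝ) : ℂ)) * ((a (x, y) : ℝ) : ℂ) with hK
  have hKc : Continuous K :=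
    (continuous_kernel hn he ha.smooth.continuous lam).comp (Continuous.prodMk_right x)
  have hemb : Topology.IsClosedEmbedding fun y : E n => (x, y) :=
    ⟨.of_comp (Continuous.prodMk_right x) continuous_snd .id,
      by
        have : (Set.range fun y : E n => (x, y)) = Prod.fst ⁻¹' {x} := by
          ext ⟨u, v⟩
          simp [eq_comm]
        rw [this]
        exact isClosed_singleton.preimage continuous_fst⟩
  have hsupp : HasCompactSupport K := by
    have h1 : HasCompactSupport fun y => a (x, y) :=
      ha.compactSupport.comp_isClosedEmbedding hemb
    refine h1.mono fun y hy => ?_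
    simp only [hK, Function.mem_support, ne_eq, mul_eq_zero, not_or, Complex.ofReal_eq_zero] at hy ⊢
    exact hy.2
  exact (hKc.integrable_of_hasCompactSupport hsupp).mul_bdd hf.aestronglyMeasurable
    (.of_forall hC)

lemma stronglyMeasurable_oscInt {n : ℕ} (hn : 4 ≤ n) (he : Even n) {a : E n × E n → ℝ}
    (ha : IsAmplitude a) (lam : ℝ) {f : E n → ℂ} (hf : Measurable f) :
    StronglyMeasurable (oscInt a lam f) := by
  have := isLocallyFiniteMeasure_vol hn
  have h : StronglyMeasurable (Function.uncurry (oscIntegrand a lam f)) :=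
    ((continuous_kernel hn he ha.smooth.continuous lam).measurable.mul
      (hf.comp measurable_snd)).stronglyMeasurable
  exact h.integral_prod_right

lemma oscInt_sum {n : ℕ} (hn : 4 ≤ n) (he : Even n) {a : E n × E n → ℝ} (ha : IsAmplitude a)
    (lam : ℝ) {ι : Type*} (s : Finset ι) {f : ι → E n → ℂ} (hf : ∀ k, Measurable (f k)) {C : ℝ}
    (hC : ∀ k y, ‖f k y‖ ≤ C) (ε : ι → ℂ) (x : E n) :
    oscInt a lam (fun y => ∑ k ∈ s, ε k * f k y) x = ∑ k ∈ s, ε k * oscInt a lam (f k) x := by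
  have h : ∀ y, oscIntegrand a lam (fun y => ∑ k ∈ s, ε k * f k y) x y
      = ∑ k ∈ s, ε k * oscIntegrand a lam (f k) x y := fun y => by
    simp only [oscIntegrand, Finset.mul_sum]
    exact Finset.sum_congr rfl fun k _ => by ring
  rw [oscInt_eq]
  simp_rw [h]
  rw [integral_finsetSum _ fun k _ =>
    (integrable_oscIntegrand hn he ha lam (hf k) (hC k) x).const_mul (ε k)]
  exact Finset.sum_congr rfl fun k _ => integral_const_mul _ _

/-- If the phases of the kernel and of the test function cancel up to a bounded error on `D`, there
is no cancellation in the oscillatory integral. -/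
lemma le_norm_oscInt_of_phase {n : ℕ} (hn : 4 ≤ n) (he : Even n) {a : E n × E n → ℝ}
    (ha : IsAmplitude a) {lam c κ : ℝ} {ψ : E n → ℝ} (hψ : Continuous ψ) {D : Set (E n)}
    (hD : MeasurableSet D) (hDfin : vol n D ≠ ⊤) {x : E n} (hκ : 0 ≤ κ)
    (hphase : ∀ y ∈ D, 0 ≤ lam * (rdist x y - c + ψ y) ∧ lam * (rdist x y - c + ψ y) ≤ 1)
    (hamp : ∀ y ∈ D, κ ≤ a (x, y)) :
    κ / 2 * (vol n D).toReal ≤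
      ‖oscInt a lam (D.indicator fun y => Complex.exp (Complex.I * ((lam * ψ y : ℝ) : ℂ))) x‖ := by
  set f : E n → ℂ := D.indicator fun y => Complex.exp (Complex.I * ((lam * ψ y : ℝ) : ℂ)) with hf
  have hfm : Measurable f := Measurable.indicator (by fun_prop) hD
  have hfb : ∀ y, ‖f y‖ ≤ 1 := fun y =>
    (norm_indicator_le_norm_self _ _).trans (norm_exp_I_mul _).le
  have hint := integrable_oscIntegrand hn he ha lam hfm hfb x
  set u : ℂ := Complex.exp (Complex.I * ((-(lam * c) : ℝ) : ℂ)) with hu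
  have hint' := hint.const_mul u
  have hre : ∀ y, D.indicator (fun _ => κ / 2) y ≤ (u * oscIntegrand a lam f x y).re := by
    intro y
    by_cases hy : y ∈ D
    · obtain ⟨h0, h1⟩ := hphase y hy
      set θ := lam * (rdist x y - c + ψ y) with hθ
      have hprod : u * oscIntegrand a lam f x y
          = ((a (x, y) : ℝ) : ℂ) * Complex.exp (((θ : ℝ) : ℂ) * Complex.I) := by
        rw [oscIntegrand, hf, Set.indicator_of_mem hy, hu]
        rw [show ∀ p q r s : ℂ, p * (q * r * s) = r * (p * q * s) from fun p q r s => by ring,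
          ← Complex.exp_add, ← Complex.exp_add]
        congr 2
        rw [hθ]
        push_cast
        ring
      rw [Set.indicator_of_mem hy, hprod, Complex.re_ofReal_mul, Complex.exp_ofReal_mul_I_re]
      have hcos : 1 / 2 ≤ Real.cos θ := by
        have := Real.one_sub_sq_div_two_le_cos (x := θ)
        nlinarith
      have := hamp y hy
      nlinarith
    · rw [Set.indicator_of_notMem hy, oscIntegrand, hf, Set.indicator_of_notMem hy]
      simp
  have hconst : Integrable (D.indicator fun _ => κ / 2) (vol n) :=
    (integrable_indicator_iff hD).2 (integrableOn_const hDfin)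
  calc κ / 2 * (vol n D).toReal = ∫ y, D.indicator (fun _ => κ / 2) y ∂(vol n) := by
        rw [integral_indicator_const _ hD, smul_eq_mul, mul_comm, measureReal_def]
    _ ≤ ∫ y, (u * oscIntegrand a lam f x y).re ∂(vol n) :=
        integral_mono hconst hint'.re hre
    _ = (u * oscInt a lam f x).re := by
        rw [oscInt_eq, ← integral_const_mul]
        exact integral_re hint'
    _ ≤ ‖u * oscInt a lam f x‖ := Complex.re_le_norm _
    _ = ‖oscInt a lam f x‖ := by rw [norm_mul, hu, norm_exp_I_mul, one_mul]

/-! ### Choice of signs -/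

lemma lintegral_enorm_sq_add_add_sub {X : Type*} [MeasurableSpace X] (μ : Measure X)
    {u v : X → ℂ} (hu : Measurable u) (hv : Measurable v) :
    ∫⁻ x, ‖u x + v x‖ₑ ^ 2 ∂μ + ∫⁻ x, ‖u x - v x‖ₑ ^ 2 ∂μ
      = 2 * (∫⁻ x, ‖u x‖ₑ ^ 2 ∂μ + ∫⁻ x, ‖v x‖ₑ ^ 2 ∂μ) := by
  have h : ∀ z : ℂ, ‖z‖ₑ ^ 2 = ENNReal.ofReal (‖z‖ ^ 2) := fun z => by
    rw [ENNReal.ofReal_pow (norm_nonneg z), ofReal_norm]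
  rw [← lintegral_add_left (by fun_prop), ← lintegral_add_left (by fun_prop),
    ← lintegral_const_mul _ (by fun_prop)]
  refine lintegral_congr fun x => ?_
  simp only [h]
  rw [← ENNReal.ofReal_add (by positivity) (by positivity),
    ← ENNReal.ofReal_add (by positivity) (by positivity),
    show (2 : ℝ≥0∞) = ENNReal.ofReal 2 by simp, ← ENNReal.ofReal_mul (by norm_num)]
  congr 1
  have := parallelogram_law_with_norm ℝ (u x) (v x)
  nlinarith

/-- A combination with suitable signs is at least as large in `L²` as in the orthogonal case. -/
lemma exists_signs {X ι : Type*} [MeasurableSpace X] (μ : Measure X) {u : ι → X → ℂ}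
    (hu : ∀ k, Measurable (u k)) (s : Finset ι) :
    ∃ ε : ι → ℂ, (∀ k, ‖ε k‖ = 1) ∧
      ∑ k ∈ s, ∫⁻ x, ‖u k x‖ₑ ^ 2 ∂μ ≤ ∫⁻ x, ‖∑ k ∈ s, ε k * u k x‖ₑ ^ 2 ∂μ := by
  classical
  induction s using Finset.induction_on with
  | empty => exact ⟨fun _ => 1, fun _ => norm_one, by simp⟩
  | insert j s hj ih =>
    obtain ⟨ε, hε, h⟩ := ih
    have hsum : ∀ c : ℂ, ∀ x, ∑ k ∈ insert j s, Function.update ε j c k * u k x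
        = ∑ k ∈ s, ε k * u k x + c * u j x := fun c x => by
      rw [Finset.sum_insert hj, Function.update_self, add_comm]
      congr 1
      exact Finset.sum_congr rfl fun k hk => by
        rw [Function.update_of_ne (ne_of_mem_of_not_mem hk hj)]
    have hnorm : ∀ c : ℂ, ‖c‖ = 1 → ∀ k, ‖Function.update ε j c k‖ = 1 := fun c hc k => by
      rcases eq_or_ne k j with rfl | hk
      · rwa [Function.update_self]
      · rw [Function.update_of_ne hk, hε]
    have hpar := lintegral_enorm_sq_add_add_sub μ
      (u := fun x => ∑ k ∈ s, ε k * u k x) (by fun_prop) (hu j)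
    have hle : ∑ k ∈ insert j s, ∫⁻ x, ‖u k x‖ₑ ^ 2 ∂μ
        ≤ ∫⁻ x, ‖∑ k ∈ s, ε k * u k x‖ₑ ^ 2 ∂μ + ∫⁻ x, ‖u j x‖ₑ ^ 2 ∂μ := by
      rw [Finset.sum_insert hj, add_comm]
      gcongr
    by_cases h1 : ∑ k ∈ insert j s, ∫⁻ x, ‖u k x‖ₑ ^ 2 ∂μ
        ≤ ∫⁻ x, ‖∑ k ∈ s, ε k * u k x + u j x‖ₑ ^ 2 ∂μ
    · exact ⟨Function.update ε j 1, hnorm 1 norm_one, by simpa only [hsum, one_mul] using h1⟩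
    by_cases h2 : ∑ k ∈ insert j s, ∫⁻ x, ‖u k x‖ₑ ^ 2 ∂μ
        ≤ ∫⁻ x, ‖∑ k ∈ s, ε k * u k x - u j x‖ₑ ^ 2 ∂μ
    · refine ⟨Function.update ε j (-1), hnorm _ (by simp), ?_⟩
      simpa only [hsum, neg_mul, one_mul, ← sub_eq_add_neg] using h2
    -- If both signs failed, the parallelogram identity would be violated.
    · push Not at h1 h2
      have h3 := ENNReal.add_lt_add h1 h2
      rw [hpar, ← two_mul] at h3
      exact absurd (mul_le_mul_right hle 2) (not_le.2 h3)

/-! ### Test functions -/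

lemma norm_le_of_abs_le {n : ℕ} {x : E n} {s : ℝ} (hs : 0 ≤ s) (h : ∀ i, |x i| ≤ s) :
    ‖x‖ ≤ √ n * s := by
  refine abs_le_of_sq_le_sq' ?_ (by positivity) |>.2
  rw [EuclideanSpace.real_norm_sq_eq, mul_pow, Real.sq_sqrt (Nat.cast_nonneg n)]
  calc _ ≤ ∑ _i : Fin n, s ^ 2 := Finset.sum_le_sum fun i _ => by
        rw [← sq_abs]; exact pow_le_pow_left₀ (abs_nonneg _) (h i) 2
    _ = n * s ^ 2 := by simp

lemma basePoint_timeIdx {n : ℕ} (hn : 4 ≤ n) : basePoint n (timeIdx hn) = -1 := by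
  simp only [basePoint, timeIdx]
  rw [if_pos (by omega)]

lemma basePoint_of_ne {n : ℕ} {hn : 4 ≤ n} {i : Fin n} (hi : i ≠ timeIdx hn) :
    basePoint n i = 0 := by
  have := val_ne_of_ne_timeIdx hi
  simp only [basePoint]
  rw [if_neg (by omega)]

/-- Near `(0, y⁰)` the amplitude and the density of the volume are bounded from below. -/
lemma exists_lower_bounds {n : ℕ} (hn : 4 ≤ n) {a : E n × E n → ℝ} (ha : IsAmplitude a) :
    ∃ κ d η : ℝ, 0 < κ ∧ 0 < d ∧ 0 < η ∧ ∀ x y : E n, ‖x‖ < η → ‖y - basePoint n‖ < η →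
      κ ≤ a (x, y) ∧ d ≤ √ (metric y).det := by
  have hapos : 0 < a (0, basePoint n) := (ha.nonneg _).lt_of_ne ha.ne_zero.symm
  have hdpos : 0 < √ (metric (basePoint n)).det := Real.sqrt_pos.2 (metric_posDef _).det_pos
  have h1 := ha.smooth.continuous.continuousAt.eventually_const_lt (half_lt_self hapos)
  have h2 : ∀ᶠ z : E n × E n in 𝓝 (0, basePoint n),
      √ (metric (basePoint n)).det / 2 < √ (metric z.2).det :=
    ((continuous_density hn).comp continuous_snd).continuousAt.eventually_const_lt
      (half_lt_self hdpos)
  obtain ⟨η, hη, h⟩ := Metric.eventually_nhds_iff.1 (h1.and h2)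
  refine ⟨_, _, η, half_pos hapos, half_pos hdpos, hη, fun x y hx hy => ?_⟩
  have := h (y := (x, y)) (by
    rw [Prod.dist_eq, max_lt_iff, dist_zero_right, dist_eq_norm]
    exact ⟨hx, hy⟩)
  exact ⟨this.1.le, this.2.le⟩

lemma le_two_mul_mul_floor {r δ : ℝ} (hδ : 0 < δ) (hδr : δ ≤ r) :
    r ≤ 2 * δ * (⌊r / δ⌋₊ : ℝ) := by
  have h1 : (1 : ℝ) ≤ ⌊r / δ⌋₊ := by
    exact_mod_cast (Nat.one_le_floor_iff _).2 ((one_le_div hδ).2 hδr)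
  have h2 := Nat.lt_floor_add_one (r / δ)
  rw [div_lt_iff₀ hδ] at h2
  nlinarith

/-- The wave packet `1_D e^{iλφ}`, where `D` is the part of the `k`-th tube over the times in
`[-1, -1 + r]` and `φ` is the linear phase attached to the tube. -/
def wave {n : ℕ} (hn : 4 ≤ n) (δ ρ r lam : ℝ) (k : Fin n → ℕ) : E n → ℂ :=
  (tube hn δ ρ (-1) (-1 + r) k).indicator fun y =>
    Complex.exp (Complex.I * ((lam * phase (gridMomentum δ k) y : ℝ) : ℂ))

lemma continuous_phase {n : ℕ} (z : Fin n → ℝ) : Continuous (phase z) := by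
  unfold phase dotProduct
  fun_prop

lemma measurable_wave {n : ℕ} (hn : 4 ≤ n) (δ ρ r lam : ℝ) (k : Fin n → ℕ) :
    Measurable (wave hn δ ρ r lam k) := by
  have := continuous_phase (gridMomentum δ k)
  exact Measurable.indicator (by fun_prop) (isClosed_tube hn _ _ _ _ k).measurableSet

lemma norm_wave_le {n : ℕ} (hn : 4 ≤ n) (δ ρ r lam : ℝ) (k : Fin n → ℕ) (y : E n) :
    ‖wave hn δ ρ r lam k y‖ ≤ 1 :=
  (norm_indicator_le_norm_self _ _).trans (norm_exp_I_mul _).le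

/-- The wave packets of all tubes are superposed, with signs: for `λ = δ⁻²` there is a function
bounded by the indicator of a fixed set whose oscillatory integral has `L²` norm at least
`c δ^{n-1}` on a set of volume at most `C δ^{n/2-1}`. -/
lemma exists_test_function {n : ℕ} (hn : 4 ≤ n) (he : Even n) {a : E n × E n → ℝ}
    (ha : IsAmplitude a) :
    ∃ B : Set (E n), MeasurableSet B ∧ vol n B ≠ ⊤ ∧ ∃ c C δ₀ : ℝ, 0 < c ∧ 0 < C ∧ 0 < δ₀ ∧
      δ₀ ≤ 1 ∧ ∀ δ : ℝ, 0 < δ → δ ≤ δ₀ → ∃ (f : E n → ℂ) (N : Set (E n)), Measurable f ∧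
        (∀ y, ‖f y‖ ≤ B.indicator 1 y) ∧
        vol n N ≤ ENNReal.ofReal (C * δ ^ (n / 2 - 1)) ∧
        ENNReal.ofReal ((c * δ ^ (n - 1)) ^ 2)
          ≤ ∫⁻ x in N, ‖oscInt a ((δ ^ 2)⁻¹) f x‖ₑ ^ 2 ∂(vol n) := by
  have := isLocallyFiniteMeasure_vol hn
  obtain ⟨κ, d, η, hκ, hd, hη, hbd⟩ := exists_lower_bounds hn ha
  have hn0 : (4 : ℝ) ≤ n := by exact_mod_cast hn
  have hsn : 0 < √ (n : ℝ) := Real.sqrt_pos.2 (by linarith)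
  set r : ℝ := min (1 / 6) (η / (6 * √ n)) with hr
  have hr0 : 0 < r := by positivity
  have hr6 : r ≤ 1 / 6 := min_le_left _ _
  have hrη : √ n * (3 * r) < η := by
    have : r ≤ η / (6 * √ n) := min_le_right _ _
    rw [le_div_iff₀ (by positivity)] at this
    nlinarith
  set A : ℝ := 1 - alpha (-1) with hA
  have hA0 : 0 < A := sub_pos.2 (alpha_lt_one _)
  have hA1 : A ≤ 1 := by linarith [alpha_nonneg (-1)]
  set β : ℝ := -alphaInt (-(1 / 2)) with hβ
  have hβ0 : 0 < β := neg_pos.2 (alphaInt_neg (by norm_num))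
  have hβ1 : β ≤ 1 := by
    have h := abs_alphaInt_le (-(1 / 2))
    rw [abs_neg, abs_of_pos (by norm_num : (0 : ℝ) < 1 / 2)] at h
    linarith [neg_abs_le (alphaInt (-(1 / 2)))]
  -- The ratio `w` of the width of the tubes and the spacing of the grid: the error of the phase is
  -- at most `4 n w² / A` and the tubes are disjoint if `2 w < β`.
  set w : ℝ := A * β / (4 * n) with hw
  have hw0 : 0 < w := by positivity
  have hwn : w * (4 * n) = A * β := by rw [hw]; field_simp
  have hAβ1 : A * β ≤ 1 := by nlinarith
  have hw1 : w ≤ 1 := by nlinarith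
  have hwβ : 2 * w < β := by nlinarith
  have hwA : 4 * n * w ^ 2 ≤ A := by nlinarith
  refine ⟨Metric.ball (basePoint n) η, Metric.isOpen_ball.measurableSet, ?_,
    κ / 2 * d * r * (2 * w) ^ (n - 1) * √ ((r * w) ^ (n - 1) * r), 2 ^ n * w ^ (n / 2 - 1), r,
    by positivity, by positivity, hr0, by linarith, fun δ hδ hδr => ?_⟩
  · exact ne_top_of_le_ne_top (isCompact_closedBall (basePoint n) η).measure_lt_top.ne
      (measure_mono Metric.ball_subset_closedBall)
  set ρ : ℝ := w * δ with hρ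
  have hρ0 : 0 ≤ ρ := by positivity
  have hρr : ρ ≤ r := by nlinarith
  set M : ℕ := ⌊r / δ⌋₊ with hM
  have hδM : δ * M ≤ r := by
    have := Nat.floor_le (div_nonneg hr0.le hδ.le)
    rw [le_div_iff₀ hδ] at this
    linarith
  set lam : ℝ := (δ ^ 2)⁻¹ with hlam
  set D : (Fin n → ℕ) → Set (E n) := tube hn δ ρ (-1) (-1 + r) with hD
  set P : (Fin n → ℕ) → Set (E n) := tube hn δ ρ 0 r with hP
  have htimeD : ∀ {k} {y : E n}, y ∈ D k → |time y| ≤ 1 := fun hy => by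
    rw [abs_le]; exact ⟨hy.1.1, by linarith [hy.1.2]⟩
  have htimeP : ∀ {k} {x : E n}, x ∈ P k → |time x| ≤ r := fun hx => by
    rw [abs_le]; exact ⟨by linarith [hx.1.1], hx.1.2⟩
  have hDball : ∀ k ∈ grid hn M, ∀ y ∈ D k, ‖y - basePoint n‖ < η := by
    intro k hk y hy
    refine (norm_le_of_abs_le (by positivity) fun i => ?_).trans_lt hrη
    rw [PiLp.sub_apply]
    by_cases hi : i = timeIdx hn
    · have h1 := hy.1.1
      have h2 := hy.1.2
      rw [time_eq hn] at h1 h2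
      rw [hi, basePoint_timeIdx, abs_le]
      constructor <;> linarith
    · rw [basePoint_of_ne hi, sub_zero]
      exact abs_le_of_mem_tube he hδ.le hδM hρr hk hy (htimeD hy) hi
  have hPcoord : ∀ k ∈ grid hn M, ∀ x ∈ P k, ∀ i, |x i| ≤ 3 * r := by
    intro k hk x hx i
    have ht := htimeP hx
    by_cases hi : i = timeIdx hn
    · rw [hi, ← time_eq hn]; linarith
    · exact abs_le_of_mem_tube he hδ.le hδM hρr hk hx (by linarith) hi
  have hPslab : ∀ k ∈ grid hn M, P k ⊆ slab n ρ := by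
    intro k hk x hx
    refine ⟨hx.1.1, fun i => ?_⟩
    split_ifs with hi
    · exact abs_le_width_of_mem_tube he le_rfl hx hi
    · exact (hPcoord k hk x hx i).trans (by linarith)
  set V : ℝ := r * (2 * ρ) ^ (n - 1) with hV
  have hV0 : 0 ≤ V := by positivity
  have hvolP : ∀ k, vol n (P k) = ENNReal.ofReal V := fun k => by
    rw [hP, vol_eq_volume (isClosed_tube hn _ _ _ _ k).measurableSet fun x hx => hx.1.1,
      volume_tube hn _ _ _ hρ0, sub_zero, ← ENNReal.ofReal_pow (by positivity),
      ← ENNReal.ofReal_mul hr0.le]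
  have hvolD : ∀ k ∈ grid hn M, vol n (D k) ≠ ⊤ ∧ d * V ≤ (vol n (D k)).toReal := by
    intro k hk
    have htop : vol n (D k) ≠ ⊤ :=
      ne_top_of_le_ne_top (isCompact_closedBall (basePoint n) η).measure_lt_top.ne
        (measure_mono fun y hy => mem_closedBall_iff_norm.2 (hDball k hk y hy).le)
    refine ⟨htop, ?_⟩
    have h := le_vol_of_le_density (isClosed_tube hn δ ρ (-1) (-1 + r) k).measurableSet
      (d := d) fun y hy => (hbd 0 y (by simpa using hη) (hDball k hk y hy)).2
    rw [volume_tube hn _ _ _ hρ0, show -1 + r - -1 = r by ring,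
      ← ENNReal.ofReal_pow (by positivity), ← ENNReal.ofReal_mul hr0.le,
      ← ENNReal.ofReal_mul hd.le] at h
    exact (ENNReal.ofReal_le_iff_le_toReal htop).1 h
  have hpoint : ∀ k ∈ grid hn M, ∀ x ∈ P k,
      κ / 2 * (d * V) ≤ ‖oscInt a lam (wave hn δ ρ r lam k) x‖ := by
    intro k hk x hx
    have hmom := isMomentum_gridMomentum hn he δ k
    refine le_trans ?_ (le_norm_oscInt_of_phase hn he ha (continuous_phase (gridMomentum δ k))
      (isClosed_tube hn _ _ _ _ k).measurableSet (hvolD k hk).1 (c := phase (gridMomentum δ k) x)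
      hκ.le (fun y hy => ?_) fun y hy => ?_)
    · have := (hvolD k hk).2
      gcongr
    · have hlo := hmom.phase_sub_le_rdist he x y
      have hup := hmom.rdist_le_phase_sub he (R := 1) (w := gridPoint δ k)
        (by linarith [hx.1.1, hy.1.2]) hy.1.1
        (norm_sub_ray_le_of_mem_tube he hρ0 hx) (norm_sub_ray_le_of_mem_tube he hρ0 hy)
      have hlam0 : 0 < lam := by positivity
      refine ⟨mul_nonneg hlam0.le (by linarith), ?_⟩
      have herr : 4 * (√ n * ρ) ^ 2 / (1 - alpha (-1)) ≤ δ ^ 2 := by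
        rw [← hA, div_le_iff₀ hA0, mul_pow, Real.sq_sqrt (by linarith), hρ]
        nlinarith [sq_nonneg δ]
      rw [hlam, inv_mul_le_iff₀ (by positivity)]
      linarith
    · refine (hbd x y ?_ (hDball k hk y hy)).1
      exact (norm_le_of_abs_le (by positivity) (hPcoord k hk x hx)).trans_lt hrη
  obtain ⟨ε, hε, hsigns⟩ := exists_signs ((vol n).restrict (slab n ρ))
    (u := fun k => oscInt a lam (wave hn δ ρ r lam k))
    (fun k => (stronglyMeasurable_oscInt hn he ha lam (measurable_wave hn δ ρ r lam k)).measurable)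
    (grid hn M)
  refine ⟨fun y => ∑ k ∈ grid hn M, ε k * wave hn δ ρ r lam k y, slab n ρ, ?_, fun y => ?_, ?_, ?_⟩
  · have := fun k => measurable_wave hn δ ρ r lam k
    fun_prop
  · change ‖∑ k ∈ grid hn M, ε k * wave hn δ ρ r lam k y‖ ≤ _
    by_cases hy : ∃ k ∈ grid hn M, y ∈ D k
    · obtain ⟨k, hk, hyk⟩ := hy
      rw [Finset.sum_eq_single_of_mem k hk fun k' hk' hne => by
        refine mul_eq_zero_of_right _ (Set.indicator_of_notMem ?_ _)
        intro hyk'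
        refine hne (eq_of_mem_tube he hδ (by linarith) ?_ hk' hk hyk' hyk)
        rw [hρ, ← hβ]
        nlinarith]
      rw [norm_mul, hε, one_mul, Set.indicator_of_mem (mem_ball_iff_norm.2 (hDball k hk y hyk))]
      exact norm_wave_le hn δ ρ r lam k y
    · push Not at hy
      rw [Finset.sum_eq_zero fun k hk =>
        mul_eq_zero_of_right _ (Set.indicator_of_notMem (hy k hk) _), norm_zero]
      exact Set.indicator_nonneg (fun _ _ => zero_le_one) y
  · refine (vol_slab_le hn he hρ0).trans_eq ?_
    rw [hρ, mul_pow, mul_assoc]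
  · simp_rw [oscInt_sum hn he ha lam (grid hn M) (measurable_wave hn δ ρ r lam)
      (norm_wave_le hn δ ρ r lam) ε]
    refine le_trans ?_ hsigns
    have hterm : ∀ k ∈ grid hn M, ENNReal.ofReal ((κ / 2 * (d * V)) ^ 2 * V)
        ≤ ∫⁻ x in slab n ρ, ‖oscInt a lam (wave hn δ ρ r lam k) x‖ₑ ^ 2 ∂(vol n) := by
      intro k hk
      calc ENNReal.ofReal ((κ / 2 * (d * V)) ^ 2 * V)
          = ∫⁻ _x in P k, ENNReal.ofReal (κ / 2 * (d * V)) ^ 2 ∂(vol n) := by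
            rw [setLIntegral_const, hvolP, ENNReal.ofReal_mul (by positivity),
              ENNReal.ofReal_pow (by positivity)]
        _ ≤ ∫⁻ x in P k, ‖oscInt a lam (wave hn δ ρ r lam k) x‖ₑ ^ 2 ∂(vol n) :=
            setLIntegral_mono' (isClosed_tube hn _ _ _ _ k).measurableSet fun x hx => by
              rw [← ofReal_norm]
              exact pow_le_pow_left' (ENNReal.ofReal_le_ofReal (hpoint k hk x hx)) 2
        _ ≤ _ := lintegral_mono_set (hPslab k hk)
    refine le_trans ?_ (Finset.sum_le_sum hterm)
    rw [Finset.sum_const, card_grid, nsmul_eq_mul, ← ENNReal.ofReal_natCast,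
      ← ENNReal.ofReal_mul (by positivity)]
    refine ENNReal.ofReal_le_ofReal ?_
    -- the number of tubes, `M ^ (n - 1)`, is at least `(r / (2 δ)) ^ (n - 1)`
    have hcount : (r * w) ^ (n - 1) ≤ (M : ℝ) ^ (n - 1) * (2 * ρ) ^ (n - 1) := by
      rw [← mul_pow]
      refine pow_le_pow_left₀ (by positivity) ?_ _
      have := le_two_mul_mul_floor hδ hδr
      rw [hρ]
      nlinarith
    have hsq : (κ / 2 * d * r * (2 * w) ^ (n - 1) * √ ((r * w) ^ (n - 1) * r) * δ ^ (n - 1)) ^ 2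
        = (κ / 2 * (d * V)) ^ 2 * r * (r * w) ^ (n - 1) := by
      have h := Real.sq_sqrt (show 0 ≤ (r * w) ^ (n - 1) * r by positivity)
      rw [hV, hρ, ← mul_assoc 2 w δ, mul_pow (2 * w) δ]
      linear_combination (κ / 2 * d * r * (2 * w) ^ (n - 1) * δ ^ (n - 1)) ^ 2 * h
    rw [hsq]
    push_cast
    calc (κ / 2 * (d * V)) ^ 2 * r * (r * w) ^ (n - 1)
        ≤ (κ / 2 * (d * V)) ^ 2 * r * ((M : ℝ) ^ (n - 1) * (2 * ρ) ^ (n - 1)) := by gcongr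
      _ = (M : ℝ) ^ (n - 1) * ((κ / 2 * (d * V)) ^ 2 * V) := by rw [hV]; ring

/-! ### Comparison of powers -/

/-- A bound `δ ^ A ≤ C δ ^ B` for all small `δ` forces `B ≤ A`. -/
lemma le_of_rpow_le_mul_rpow {A B C δ₀ : ℝ} (hδ₀ : 0 < δ₀)
    (h : ∀ δ : ℝ, 0 < δ → δ ≤ δ₀ → δ ^ A ≤ C * δ ^ B) : B ≤ A := by
  by_contra! hAB
  have hlim : Filter.Tendsto (fun δ : ℝ => C * δ ^ (B - A)) (𝓝[>] 0) (𝓝 0) := by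
    have h1 : ContinuousAt (fun δ : ℝ => δ ^ (B - A)) 0 :=
      Real.continuousAt_rpow_const _ _ (Or.inr (sub_pos.2 hAB).le)
    have h2 := (h1.tendsto.mono_left (nhdsWithin_le_nhds (s := Set.Ioi 0))).const_mul C
    simpa [Real.zero_rpow (sub_pos.2 hAB).ne'] using h2
  have hev : ∀ᶠ δ : ℝ in 𝓝[>] 0, 1 ≤ C * δ ^ (B - A) := by
    filter_upwards [Ioc_mem_nhdsGT hδ₀] with δ hδ
    have hpos := Real.rpow_pos_of_pos hδ.1 A
    rw [Real.rpow_sub hδ.1, ← mul_div_assoc, le_div_iff₀ hpos, one_mul]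
    exact h δ hδ.1 hδ.2
  exact absurd (ge_of_tendsto hlim hev) (by norm_num)

/-- The estimate fails for `q` below the critical exponent, whatever `p` is: the test functions are
bounded and live on a fixed set. -/
lemma inv_le_of_oscEstimate {n : ℕ} (hn : 4 ≤ n) (he : Even n) {a : E n × E n → ℝ}
    (ha : IsAmplitude a) {p q : ℝ≥0∞} (hq : 2 ≤ q) (hest : OscEstimate a p q) :
    (q⁻¹).toReal * (2 * (3 * n + 2)) ≤ 3 * n - 2 := by
  obtain ⟨B, hB, hBfin, c, C, δ₀, hc, hC, hδ₀, hδ₁, htest⟩ := exists_test_function hn he ha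
  set θ : ℝ := (q⁻¹).toReal with hθ
  have hθ0 : 0 ≤ θ := ENNReal.toReal_nonneg
  have hθ2 : θ ≤ 1 / 2 := by
    have := ENNReal.toReal_mono (by simp) (ENNReal.inv_le_inv.2 hq)
    rw [ENNReal.toReal_inv 2, ENNReal.toReal_ofNat] at this
    rwa [one_div]
  have h1θ : (q⁻¹).toReal = 1 / q.toReal := by rw [ENNReal.toReal_inv, one_div]
  have hn2 : ((n / 2 - 1 : ℕ) : ℝ) = n / 2 - 1 := by
    obtain ⟨m, rfl⟩ := he
    rw [show (m + m) / 2 - 1 = m - 1 by omega, Nat.cast_sub (by omega)]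
    push_cast
    ring
  have hn1 : ((n - 1 : ℕ) : ℝ) = n - 1 := by rw [Nat.cast_sub (by omega)]; simp
  -- Hölder's inequality on the small set, with exponents `2` and `q`, read as powers of `δ`.
  have key : ∀ ε : ℝ, 0 < ε →
      2 * (n * θ - ε) + (n / 2 - 1) * (1 / 2 - θ) ≤ n - 1 := by
    intro ε hε
    obtain ⟨K, hK⟩ := hest ε hε
    set I : ℝ≥0∞ := eLpNorm (B.indicator fun _ => (1 : ℝ)) p (vol n) with hI
    have hIfin : I ≠ ⊤ := (memLp_indicator_const p hB (1 : ℝ) (Or.inr hBfin)).eLpNorm_ne_top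
    refine le_of_rpow_le_mul_rpow (C := c⁻¹ * (|K| * I.toReal * C ^ (1 / 2 - θ))) hδ₀
      fun δ hδ hδδ₀ => ?_
    obtain ⟨f, N, hf, hfB, hN, hlow⟩ := htest δ hδ hδδ₀
    set lam : ℝ := (δ ^ 2)⁻¹ with hlam
    have hlam1 : 1 ≤ lam := (one_le_inv₀ (by positivity)).2 (pow_le_one₀ hδ.le (hδδ₀.trans hδ₁))
    have hfp : eLpNorm f p (vol n) ≤ I := by
      refine eLpNorm_mono fun y => (hfB y).trans ?_
      by_cases hy : y ∈ B <;> simp [hy]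
    have hmem : MemLp f p (vol n) := ⟨hf.aestronglyMeasurable, hfp.trans_lt hIfin.lt_top⟩
    have hosc := stronglyMeasurable_oscInt hn he ha lam hf
    have h2 : eLpNorm (oscInt a lam f) 2 ((vol n).restrict N) ^ 2
        = ∫⁻ x in N, ‖oscInt a lam f x‖ₑ ^ 2 ∂(vol n) := by
      have := eLpNorm_nnreal_pow_eq_lintegral (p := 2) (f := oscInt a lam f)
        (μ := (vol n).restrict N) two_ne_zero
      simpa only [ENNReal.coe_ofNat, NNReal.coe_ofNat, ENNReal.rpow_ofNat] using this
    have hhold := eLpNorm_le_eLpNorm_mul_rpow_measure_univ (μ := (vol n).restrict N) hq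
      hosc.aestronglyMeasurable
    rw [Measure.restrict_apply_univ, ← h1θ, ← hθ, ENNReal.toReal_ofNat] at hhold
    have hup : eLpNorm (oscInt a lam f) 2 ((vol n).restrict N)
        ≤ ENNReal.ofReal (|K| * lam ^ (-(n : ℝ) * θ + ε) * I.toReal
          * (C * δ ^ (n / 2 - 1)) ^ (1 / 2 - θ)) := by
      refine hhold.trans ?_
      rw [ENNReal.ofReal_mul (by positivity), ENNReal.ofReal_mul (by positivity),
        ENNReal.ofReal_toReal hIfin,
        ← ENNReal.ofReal_rpow_of_nonneg (by positivity) (by linarith)]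
      refine mul_le_mul' ?_ (ENNReal.rpow_le_rpow hN (by linarith))
      refine (eLpNorm_mono_measure _ Measure.restrict_le_self).trans
        ((hK lam hlam1 f hmem).trans (mul_le_mul' (ENNReal.ofReal_le_ofReal ?_) hfp))
      gcongr
      exact le_abs_self K
    have hlow' : ENNReal.ofReal (c * δ ^ (n - 1))
        ≤ eLpNorm (oscInt a lam f) 2 ((vol n).restrict N) := by
      rw [← h2, ENNReal.ofReal_pow (by positivity)] at hlow
      exact (ENNReal.pow_le_pow_left_iff two_ne_zero).1 hlow
    have hfin := (ENNReal.ofReal_le_ofReal_iff (by positivity)).1 (hlow'.trans hup)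
    have hlamδ : lam ^ (-(n : ℝ) * θ + ε) = δ ^ (2 * (n * θ - ε)) := by
      rw [hlam, ← Real.rpow_natCast, ← Real.rpow_neg hδ.le, ← Real.rpow_mul hδ.le]
      congr 1
      push_cast
      ring
    have hNδ : (C * δ ^ (n / 2 - 1)) ^ (1 / 2 - θ)
        = C ^ (1 / 2 - θ) * δ ^ (((n : ℝ) / 2 - 1) * (1 / 2 - θ)) := by
      rw [Real.mul_rpow hC.le (by positivity), ← Real.rpow_natCast, hn2, ← Real.rpow_mul hδ.le]
    rw [hlamδ, hNδ, ← Real.rpow_natCast, hn1] at hfin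
    have hdiv := mul_le_mul_of_nonneg_left hfin (inv_pos.2 hc).le
    rw [inv_mul_cancel_left₀ hc.ne'] at hdiv
    rw [Real.rpow_add hδ]
    exact hdiv.trans_eq (by ring)
  have hlim : 2 * (n * θ) + ((n : ℝ) / 2 - 1) * (1 / 2 - θ) ≤ n - 1 :=
    le_of_forall_pos_le_add fun ε hε => by linarith [key (ε / 2) (half_pos hε)]
  nlinarith

lemma exists_isAmplitude {n : ℕ} (hn : 4 ≤ n) : ∃ a : E n × E n → ℝ, IsAmplitude a := by
  have hne : (0 : E n) ≠ basePoint n := fun h => by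
    have := congrArg (fun x : E n => x (timeIdx hn)) h
    simp only [basePoint_timeIdx, PiLp.zero_apply] at this
    norm_num at this
  have hopen : IsOpen {z : E n × E n | z.1 ≠ z.2} :=
    isOpen_ne_fun continuous_fst continuous_snd
  obtain ⟨a, hsupp, hcomp, hsmooth, hrange, hone⟩ :=
    exists_contDiff_tsupport_subset (n := ⊤) (hopen.mem_nhds (x := ((0 : E n), basePoint n)) hne)
  refine ⟨a, hsmooth, hcomp, fun z => (hrange ⟨z, rfl⟩).1, fun x => ?_,
    by rw [hone]; exact one_ne_zero⟩
  have : (tsupport a)ᶜ ∈ 𝓝 (x, x) :=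
    (isClosed_tsupport a).isOpen_compl.mem_nhds fun h => hsupp h rfl
  filter_upwards [this] with z hz
  exact image_eq_zero_of_notMem_tsupport hz

lemma le_of_oscEstimate {n : ℕ} (hn : 4 ≤ n) (he : Even n) {a : E n × E n → ℝ}
    (ha : IsAmplitude a) {p q : ℝ≥0∞} (hq : ENNReal.ofReal (2 * n / (n - 1)) < q)
    (hest : OscEstimate a p q) : ENNReal.ofReal (2 * (3 * n + 2) / (3 * n - 2)) ≤ q := by
  have hn0 : (4 : ℝ) ≤ n := by exact_mod_cast hn
  have hq2 : 2 ≤ q := by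
    refine le_trans ?_ hq.le
    rw [show (2 : ℝ≥0∞) = ENNReal.ofReal 2 by simp]
    refine ENNReal.ofReal_le_ofReal ?_
    rw [le_div_iff₀ (by linarith)]
    linarith
  rcases eq_or_ne q ⊤ with rfl | hqt
  · exact le_top
  have h := inv_le_of_oscEstimate hn he ha hq2 hest
  have hqpos : 0 < q.toReal := ENNReal.toReal_pos (by positivity) hqt
  rw [ENNReal.toReal_inv, inv_mul_le_iff₀ hqpos] at h
  rw [ENNReal.ofReal_le_iff_le_toReal hqt, div_le_iff₀ (by linarith)]
  exact h

end CurvedOsc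

end

theorem mainTheorem6 (n : ℕ) (hn : 4 ≤ n) (heven : Even n) :
    (2 * n / (n - 1) : ℝ) < 2 * (3 * n + 2) / (3 * n - 2) ∧
    (∃ a : CurvedOsc.E n × CurvedOsc.E n → ℝ, CurvedOsc.IsAmplitude a) ∧
    ∀ a : CurvedOsc.E n × CurvedOsc.E n → ℝ, CurvedOsc.IsAmplitude a →
      (∀ p p' q : ℝ≥0∞, p.HolderConjugate p' →
        q = ENNReal.ofReal ((n + 1) / (n - 1)) * p' →
        ENNReal.ofReal (2 * n / (n - 1)) < q →
        CurvedOsc.OscEstimate a p q →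
        ENNReal.ofReal (2 * (3 * n + 2) / (3 * n - 2)) ≤ q) ∧
      (∀ q : ℝ≥0∞, ENNReal.ofReal (2 * n / (n - 1)) < q →
        CurvedOsc.OscEstimate a ∞ q →
        ENNReal.ofReal (2 * (3 * n + 2) / (3 * n - 2)) ≤ q) := by
  have hn0 : (4 : ℝ) ≤ n := by exact_mod_cast hn
  refine ⟨?_, CurvedOsc.exists_isAmplitude hn, fun a ha => ⟨fun p p' q _ _ hq hest =>
    CurvedOsc.le_of_oscEstimate hn heven ha hq hest, fun q hq hest =>
    CurvedOsc.le_of_oscEstimate hn heven ha hq hest⟩⟩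
  rw [div_lt_div_iff₀ (by linarith) (by linarith)]
  nlinarith
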